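/- For $m\ge 0$ and a skew-symmetric $\Theta\in M_m(\mathbb R)$ let $A_\Theta$ be the noncommutative torus, i.e. the universal unital $C^*$-algebra generated by unitaries $U_1,\dots,U_m$ with $U_kU_j=e^{2\pi i\Theta_{j,k}}U_jU_k$, and put $U^x=U_1^{x_1}\cdots U_m^{x_m}$ for $x\in\mathbb Z^m$. Call $\Theta$ nondegenerate if $x=0$ is the only $x\in\mathbb Z^m$ with $e^{2\pi i\langle x,\Theta y\rangle}=1$ for all $y\in\mathbb Z^m$. The GNS space of the canonical trace is $L^2(A_\Theta,\tau_\Theta)=\ell^2(\mathbb Z^m)$, with $\delta_x=\Lambda(U^x)$, where $\Lambda(a)$ denotes the GNS vector of $a\in A_\Theta$. For a Hilbert space $S$, $A_\Theta$ acts on $L^2(A_\Theta,\tau_\Theta)\otimes S$ by the left regular representation on the first factor. A *spectral triple* $(A,H,D)$ on a unital $C^*$-algebra $A$ consists of a faithful unital representation $\pi\colon A\to\mathcal B(H)$ and a selfadjoint operator $D$ on $H$ with compact resolvent such that $A^\infty(D)=\{a\in A:[D,\pi(a)]\text{ is densely defined and extends to a bounded operator}\}$ is dense in $A$. For a set $G$,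 a nonzero finite-dimensional complex Hilbert space $S$ and $F\colon G\to\mathrm{End}(S)_{\mathrm{sa}}$, let $D_F$ be the diagonal operator $(\xi_g)_g\mapsto(F(g)\xi_g)_g$ on $\ell^2(G)\otimes S=\bigoplus_{g\in G}S$ with domain $\{(\xi_g)_g:\sum_g\|F(g)\xi_g\|^2<\infty\}$. When $G$ is an abelian group consider the conditions (a) for every $R>0$ the vector space $\bigoplus_{g\in G,\ \mathrm{Spec}(F(g))\cap[-R,R]\ne\varnothing}S$ is finite-dimensional; (b) for every $h\in G$, $\sup_{g\in G}\|F(g+h)-F(g)\|<\infty$. Let $\Theta_n\in M_{m_n}(\mathbb R)$ ($n\ge1$) be nondegenerate skew-symmetric matrices, $M_n\in M_{m_{n+1}\times m_n}(\mathbb Z)$ and $z_n\in\mathbb T^{m_n}$ such that $\Theta_n-M_n^t\Theta_{n+1}M_n$ is an integer skew-symmetric matrix. Let $A_n=A_{\Theta_n}$ and let $\varphi_n\colon A_n\to A_{n+1}$ be the unital $*$-homomorphism that sends the $j$-th generator of $A_n$ to $(z_n)_jV^{M_ne_j}$, where $V^y$ ($y\in\mathbb Z^{m_{n+1}}$) are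 the ordered monomials in the generators of $A_{n+1}$. Fix a nonzero finite-dimensional complex Hilbert space $S$ and functions $F_n\colon\mathbb Z^{m_n}\to\mathrm{End}(S)_{\mathrm{sa}}$ satisfying (a) and (b) (with $G=\mathbb Z^{m_n}$) and $F_{n+1}(M_nx)=F_n(x)$ for all $n$ and all $x\in\mathbb Z^{m_n}$. Put $H_n=L^2(A_n,\tau_n)\otimes S=\ell^2(\mathbb Z^{m_n})\otimes S$ and $D_n=D_{F_n}$, and assume $\varphi_n(A_n^\infty(D_n))\subseteq A_{n+1}^\infty(D_{n+1})$ for all $n$. Let $G_\infty=\varinjlim(\mathbb Z^{m_n},M_n)$, and let $[x,n]\in G_\infty$ be the class of $x\in\mathbb Z^{m_n}$. Then: 1. $F_\infty([x,n])=F_n(x)$ defines a function $F_\infty\colon G_\infty\to\mathrm{End}(S)_{\mathrm{sa}}$. 2. There are unique isometries $I_n\colon H_n\to H_{n+1}$ with $I_n(\Lambda_n(a)\otimes\xi)=\Lambda_{n+1}(\varphi_n(a))\otimes\xi$ for $a\in A_n$, $\xi\in S$. Let $A_{\mathrm{pro}}=\varinjlim(A_n,\varphi_n)$ (as $C^*$-algebra)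 and $H_{\mathrm{pro}}=\varinjlim(H_n,I_n)$ (as Hilbert space), with canonical maps $\iota_n\colon A_n\to A_{\mathrm{pro}}$ and $\jmath_n\colon H_n\to H_{\mathrm{pro}}$. The prescription $\jmath_n\eta\mapsto\jmath_nD_n\eta$ ($\eta\in\mathrm{Dom}(D_n)$) is a well-defined, densely defined, closable operator on $\bigcup_n\jmath_n(\mathrm{Dom}(D_n))$; let $D_{\mathrm{pro}}$ be its closure. There is a unique unital representation of $A_{\mathrm{pro}}$ on $H_{\mathrm{pro}}$ in which $\iota_n(a)\jmath_n\eta=\jmath_n(a\eta)$ for all $n$, $a\in A_n$, $\eta\in H_n$. 3. There are a unitary $V\colon H_{\mathrm{pro}}\to\ell^2(G_\infty)\otimes S$ and phases $\chi_n(x)\in\mathbb T$ with $V\jmath_n(\delta_x\otimes\xi)=\chi_n(x)\,\delta_{[x,n]}\otimes\xi$ for all $n$, $x\in\mathbb Z^{m_n}$, $\xi\in S$, and $VD_{\mathrm{pro}}V^*=D_{F_\infty}$ (equality of domains included). 4. If $F_\infty$ satisfies (a) and (b) with $G=G_\infty$, then the inductive realization $(A_{\mathrm{pro}},H_{\mathrm{pro}},D_{\mathrm{pro}})$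 is a spectral triple on $A_{\mathrm{pro}}$. -/

import Mathlib

open scoped ENNReal Matrix

noncomputable section

namespace Protorus

/-! ### Noncommutative tori as universal C⋆-algebras -/

instance lpInftyCStarAlgebra {ι : Type*} {A : ι → Type*} [∀ i, Nontrivial (A i)]
    [∀ i, CStarAlgebra (A i)] : CStarAlgebra (lp A ∞) where

/-- `e t = exp (2π i t)` as a point of the unit circle. -/
def e (t : ℝ) : Circle := Circle.exp (2 * Real.pi * t)

lemma e_add (s t : ℝ) : e (s + t) = e s * e t := by
  simp [e, mul_add, Circle.exp_add]

lemma e_zero : e 0 = 1 := by simp [e]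

lemma e_neg (t : ℝ) : e (-t) = (e t)⁻¹ := by
  simp [e, Circle.exp_neg]

lemma e_int (k : ℤ) : e k = 1 := by
  rw [e, mul_comm, Circle.exp_eq_one]
  exact ⟨k, rfl⟩

/-- Scalars of modulus one as unitaries of a unital C⋆-algebra. -/
def scalarUnitary (B : Type*) [CStarAlgebra B] : Circle →* unitary B where
  toFun z := ⟨algebraMap ℂ B z, by
    rw [Unitary.mem_iff, ← algebraMap_star_comm, ← map_mul, ← map_mul]
    simp [← Circle.coe_inv_eq_conj]⟩
  map_one' := by ext; simp
  map_mul' z w := by ext; simp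

lemma scalarUnitary_comm {B : Type*} [CStarAlgebra B] (z : Circle) (b : unitary B) :
    scalarUnitary B z * b = b * scalarUnitary B z := by
  ext
  exact Algebra.commutes (z : ℂ) (b : B)

/-- The relations `u_k u_j = exp(2π i Θ_{j,k}) u_j u_k` for a family of unitaries. -/
def TorusRelations {m : ℕ} (Θ : Matrix (Fin m) (Fin m) ℝ) {B : Type*} [CStarAlgebra B]
    (u : Fin m → unitary B) : Prop :=
  ∀ j k, (u k : B) * u j = (e (Θ j k) : ℂ) • ((u j : B) * u k)

/-- The ordered monomial `u^x = u_1^{x_1} ⋯ u_m^{x_m}`. -/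
def monomial {m : ℕ} {G : Type*} [Group G] (u : Fin m → G) (x : Fin m → ℤ) : G :=
  (List.ofFn fun i => u i ^ x i).prod

lemma map_monomial {m : ℕ} {G G' : Type*} [Group G] [Group G'] (f : G →* G') (u : Fin m → G)
    (x : Fin m → ℤ) : f (monomial u x) = monomial (fun i => f (u i)) x := by
  simp [monomial, map_list_prod, List.map_ofFn, Function.comp_def]

/-- The map induced on unitary groups by a unital ⋆-homomorphism. -/
def unitaryMap {A B : Type*} [CStarAlgebra A] [CStarAlgebra B] (f : A →⋆ₐ[ℂ] B) :
    unitary A →* unitary B where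
  toFun u := ⟨f u, by
    rw [Unitary.mem_iff, ← map_star, ← map_mul, ← map_mul]
    simp⟩
  map_one' := by ext; simp
  map_mul' u v := by ext; simp

/-- A nonzero unital C⋆-algebra with unitaries satisfying the relations of the noncommutative
torus with parameter `Θ`. -/
structure TorusModel {m : ℕ} (Θ : Matrix (Fin m) (Fin m) ℝ) where
  B : Type
  [cstar : CStarAlgebra B]
  [nontrivial : Nontrivial B]
  u : Fin m → unitary B
  rel : TorusRelations Θ u

attribute [instance] TorusModel.cstar TorusModel.nontrivial

/-- The family of all the `j`-th unitaries of all models, as a unitary in the product. -/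
def tautologicalUnitary {m : ℕ} (Θ : Matrix (Fin m) (Fin m) ℝ) (j : Fin m) :
    unitary (lp (fun r : TorusModel Θ => r.B) ∞) :=
  ⟨⟨fun r => (r.u j : r.B), memℓp_infty ⟨1, by
      rintro _ ⟨r, rfl⟩
      exact (CStarRing.norm_coe_unitary (r.u j)).le⟩⟩, by
    rw [Unitary.mem_iff]
    constructor <;> ext r <;> simp [lp.infty_coeFn_mul]⟩

/-- The noncommutative torus `A_Θ`: the universal unital C⋆-algebra generated by unitaries
`U_1, …, U_m` with `U_k U_j = exp(2π i Θ_{j,k}) U_j U_k`, realized in the usual way as the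
C⋆-subalgebra generated by the tautological unitaries in the product of all models. (A C⋆-algebra
generated by finitely many elements is isomorphic to one in `Type`, so that no model is missed.) -/
def NCTorus {m : ℕ} (Θ : Matrix (Fin m) (Fin m) ℝ) :
    StarSubalgebra ℂ (lp (fun r : TorusModel Θ => r.B) ∞) :=
  (StarAlgebra.adjoin ℂ
    (Set.range fun j => (tautologicalUnitary Θ j : lp (fun r : TorusModel Θ => r.B) ∞))
    ).topologicalClosure

instance {m : ℕ} (Θ : Matrix (Fin m) (Fin m) ℝ) :
    IsClosed (NCTorus Θ : Set (lp (fun r : TorusModel Θ => r.B) ∞)) :=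
  StarSubalgebra.isClosed_topologicalClosure _

/-- The canonical generators of `A_Θ`. -/
def NCTorus.U {m : ℕ} (Θ : Matrix (Fin m) (Fin m) ℝ) (j : Fin m) : unitary (NCTorus Θ) :=
  ⟨⟨tautologicalUnitary Θ j,
      StarSubalgebra.le_topologicalClosure _ (StarAlgebra.subset_adjoin ℂ _ ⟨j, rfl⟩)⟩, by
    rw [Unitary.mem_iff]
    constructor <;> ext1
    · exact (Unitary.mem_iff.1 (tautologicalUnitary Θ j).2).1
    · exact (Unitary.mem_iff.1 (tautologicalUnitary Θ j).2).2⟩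

/-- Evaluation of the product of all models at one of them. -/
def evalProd {m : ℕ} {Θ : Matrix (Fin m) (Fin m) ℝ} (r : TorusModel Θ) :
    lp (fun r : TorusModel Θ => r.B) ∞ →⋆ₐ[ℂ] r.B where
  toFun f := f r
  map_one' := rfl
  map_mul' _ _ := rfl
  map_zero' := rfl
  map_add' _ _ := rfl
  commutes' _ := rfl
  map_star' _ := rfl

/-- The homomorphism `A_Θ → B` given by the universal property of `A_Θ`. -/
def NCTorus.lift {m : ℕ} {Θ : Matrix (Fin m) (Fin m) ℝ} (r : TorusModel Θ) :
    NCTorus Θ →⋆ₐ[ℂ] r.B :=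
  (evalProd r).comp (NCTorus Θ).subtype

lemma NCTorus.lift_U {m : ℕ} {Θ : Matrix (Fin m) (Fin m) ℝ} (r : TorusModel Θ) (j : Fin m) :
    NCTorus.lift r (NCTorus.U Θ j : NCTorus Θ) = r.u j := rfl

/-! ### Toric homomorphisms -/

lemma monomial_comm {m : ℕ} {B : Type*} [CStarAlgebra B] (u : Fin m → unitary B) (b : unitary B)
    (t : Fin m → ℝ) (h : ∀ k, u k * b = scalarUnitary B (e (t k)) * (b * u k))
    (y : Fin m → ℤ) :
    monomial u y * b = scalarUnitary B (e (∑ k, y k * t k)) * (b * monomial u y) := by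
  let P : Subgroup (unitary B × Multiplicative ℝ) :=
    { carrier := {p | p.1 * b = scalarUnitary B (e p.2.toAdd) * (b * p.1)}
      one_mem' := by simp [e_zero]
      mul_mem' := by
        rintro ⟨p, s⟩ ⟨q, t⟩ hp hq
        simp only [Set.mem_ofPred_eq, Prod.mk_mul_mk, toAdd_mul, e_add, map_mul] at *
        rw [mul_assoc, hq, ← mul_assoc, ← scalarUnitary_comm, mul_assoc, ← mul_assoc p, hp]
        simp only [← mul_assoc]
        rw [scalarUnitary_comm]
      inv_mem' := by
        rintro ⟨p, s⟩ hp
        simp only [Set.mem_ofPred_eq, Prod.inv_mk, toAdd_inv, e_neg, map_inv] at *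
        rw [inv_mul_eq_iff_eq_mul, ← mul_assoc, ← mul_assoc, eq_mul_inv_iff_mul_eq,
          ← map_inv, ← scalarUnitary_comm, mul_assoc, hp, map_inv, inv_mul_cancel_left] }
  have hP : monomial (fun k => ((u k, Multiplicative.ofAdd (t k)) :
      unitary B × Multiplicative ℝ)) y ∈ P :=
    Subgroup.list_prod_mem _ (by
      intro a ha
      obtain ⟨i, rfl⟩ := List.mem_ofFn.1 ha
      exact P.zpow_mem (h i) _)
  have h1 := map_monomial (MonoidHom.fst (unitary B) (Multiplicative ℝ))
    (fun k => (u k, Multiplicative.ofAdd (t k))) y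
  have h2 := map_monomial (MonoidHom.snd (unitary B) (Multiplicative ℝ))
    (fun k => (u k, Multiplicative.ofAdd (t k))) y
  have h3 : (monomial (fun k => Multiplicative.ofAdd (t k)) y).toAdd = ∑ k, y k * t k := by
    simp [monomial, List.prod_ofFn, toAdd_prod]
  have h4 : _ * b = scalarUnitary B (e (Multiplicative.toAdd _)) * (b * _) := hP
  simp only [MonoidHom.coe_fst, MonoidHom.coe_snd] at h1 h2
  rwa [h1, h2, h3] at h4

lemma TorusRelations.group {m : ℕ} {Θ : Matrix (Fin m) (Fin m) ℝ} {B : Type*} [CStarAlgebra B]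
    {u : Fin m → unitary B} :
    TorusRelations Θ u ↔ ∀ j k, u k * u j = scalarUnitary B (e (Θ j k)) * (u j * u k) := by
  refine forall₂_congr fun j k => ?_
  rw [Subtype.ext_iff]
  simp [scalarUnitary, Algebra.smul_def]

lemma comm_symm {B : Type*} [CStarAlgebra B] {a b : unitary B} {t : ℝ}
    (h : a * b = scalarUnitary B (e t) * (b * a)) :
    b * a = scalarUnitary B (e (-t)) * (a * b) := by
  rw [h, e_neg, map_inv, inv_mul_cancel_left]

/-- `u^y u^x = exp(2π i ⟨x, Θ y⟩) u^x u^y`. -/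
lemma TorusRelations.monomial_mul {m : ℕ} {Θ : Matrix (Fin m) (Fin m) ℝ} {B : Type*}
    [CStarAlgebra B] {u : Fin m → unitary B} (h : TorusRelations Θ u) (x y : Fin m → ℤ) :
    monomial u y * monomial u x =
      scalarUnitary B (e (∑ j, x j * ∑ k, y k * Θ j k)) * (monomial u x * monomial u y) := by
  have h1 : ∀ j, monomial u y * u j =
      scalarUnitary B (e (∑ k, y k * Θ j k)) * (u j * monomial u y) := fun j =>
    monomial_comm u (u j) (fun k => Θ j k) (fun k => TorusRelations.group.1 h j k) y
  have h2 := comm_symm (monomial_comm u (monomial u y) _ (fun j => comm_symm (h1 j)) x)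
  simpa using h2

/-- `Θ ≡ Mᵗ Ψ M` modulo integer-valued skew-symmetric matrices. -/
def ToricCongruence {m n : ℕ} (Θ : Matrix (Fin m) (Fin m) ℝ) (Ψ : Matrix (Fin n) (Fin n) ℝ)
    (M : Matrix (Fin n) (Fin m) ℤ) : Prop :=
  ∃ K : Matrix (Fin m) (Fin m) ℤ, Kᵀ = -K ∧
    Θ - (M.map (Int.cast : ℤ → ℝ))ᵀ * Ψ * M.map (Int.cast : ℤ → ℝ) = K.map (Int.cast : ℤ → ℝ)

/-- The unitaries `z_j V^{M e_j}` in a model of `A_Ψ` form a model of `A_Θ`. -/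
def TorusModel.pullback {m n : ℕ} {Θ : Matrix (Fin m) (Fin m) ℝ} {Ψ : Matrix (Fin n) (Fin n) ℝ}
    {M : Matrix (Fin n) (Fin m) ℤ} (z : Fin m → Circle) (h : ToricCongruence Θ Ψ M)
    (r : TorusModel Ψ) : TorusModel Θ where
  B := r.B
  u j := scalarUnitary r.B (z j) * monomial r.u (fun i => M i j)
  rel := by
    obtain ⟨K, -, hK⟩ := h
    rw [TorusRelations.group]
    intro j k
    have key : e (Θ j k) = e (∑ p, M p j * ∑ q, M q k * Ψ p q) := by
      have h1 := congrFun (congrFun hK j) k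
      have h2 : ((M.map (Int.cast : ℤ → ℝ))ᵀ * Ψ * M.map (Int.cast : ℤ → ℝ)) j k =
          ∑ p, M p j * ∑ q, M q k * Ψ p q := by
        simp only [Matrix.mul_apply, Matrix.transpose_apply, Matrix.map_apply, Finset.sum_mul,
          Finset.mul_sum]
        rw [Finset.sum_comm]
        exact Finset.sum_congr rfl fun p _ => Finset.sum_congr rfl fun q _ => by ring
      rw [Matrix.sub_apply, h2, Matrix.map_apply, sub_eq_iff_eq_add] at h1
      rw [h1, e_add, e_int, one_mul]
    have h3 := r.rel.monomial_mul (fun i => M i j) (fun i => M i k)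
    rw [key]
    generalize monomial r.u (fun i => M i j) = a at *
    generalize monomial r.u (fun i => M i k) = b at *
    have hc : ∀ (w : Circle) (v : unitary r.B), Commute v (scalarUnitary r.B w) :=
      fun w v => (scalarUnitary_comm w v).symm
    rw [(hc (z j) b).mul_mul_mul_comm, (hc (z k) a).mul_mul_mul_comm, h3,
      (hc (z k) (scalarUnitary r.B (z j))).eq, ← mul_assoc _ (scalarUnitary r.B (e _)),
      ← mul_assoc (scalarUnitary r.B (e _)), (scalarUnitary_comm (e _) _)]

/-- Precomposition with `TorusModel.pullback`, on the products of all models. -/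
def pullbackProd {m n : ℕ} {Θ : Matrix (Fin m) (Fin m) ℝ} {Ψ : Matrix (Fin n) (Fin n) ℝ}
    {M : Matrix (Fin n) (Fin m) ℤ} (z : Fin m → Circle) (h : ToricCongruence Θ Ψ M) :
    lp (fun r : TorusModel Θ => r.B) ∞ →⋆ₐ[ℂ] lp (fun r : TorusModel Ψ => r.B) ∞ where
  toFun f := ⟨fun r => f (r.pullback z h), memℓp_infty ⟨‖f‖, by
    rintro _ ⟨r, rfl⟩
    exact lp.norm_apply_le_norm ENNReal.top_ne_zero f (r.pullback z h)⟩⟩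
  map_one' := rfl
  map_mul' _ _ := rfl
  map_zero' := rfl
  map_add' _ _ := rfl
  commutes' _ := rfl
  map_star' _ := rfl

lemma NCTorus.coe_monomial {m : ℕ} (Θ : Matrix (Fin m) (Fin m) ℝ) (x : Fin m → ℤ) :
    (((monomial (NCTorus.U Θ) x : unitary (NCTorus Θ)) : NCTorus Θ) :
      lp (fun r : TorusModel Θ => r.B) ∞) = (monomial (tautologicalUnitary Θ) x :
        unitary (lp (fun r : TorusModel Θ => r.B) ∞)) :=
  congrArg Subtype.val (map_monomial (unitaryMap (NCTorus Θ).subtype) (NCTorus.U Θ) x)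

lemma pullbackProd_tautological {m n : ℕ} {Θ : Matrix (Fin m) (Fin m) ℝ}
    {Ψ : Matrix (Fin n) (Fin n) ℝ} {M : Matrix (Fin n) (Fin m) ℤ} (z : Fin m → Circle)
    (h : ToricCongruence Θ Ψ M) (j : Fin m) :
    pullbackProd z h (tautologicalUnitary Θ j : lp (fun r : TorusModel Θ => r.B) ∞) =
      (z j : ℂ) • (monomial (tautologicalUnitary Ψ) (fun i => M i j) :
        unitary (lp (fun r : TorusModel Ψ => r.B) ∞)) := by
  ext r
  have h1 := congrArg Subtype.val
    (map_monomial (unitaryMap (evalProd r)) (tautologicalUnitary Ψ) (fun i => M i j))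
  have h2 : pullbackProd z h (tautologicalUnitary Θ j : lp (fun r : TorusModel Θ => r.B) ∞) r =
      (z j : ℂ) • ((monomial r.u (fun i => M i j) : unitary r.B) : r.B) :=
    (Algebra.smul_def _ _).symm
  exact h2.trans (congrArg (fun w => (z j : ℂ) • w) h1.symm)

lemma pullbackProd_mem {m n : ℕ} {Θ : Matrix (Fin m) (Fin m) ℝ} {Ψ : Matrix (Fin n) (Fin n) ℝ}
    {M : Matrix (Fin n) (Fin m) ℤ} (z : Fin m → Circle) (h : ToricCongruence Θ Ψ M)
    (a : NCTorus Θ) : pullbackProd z h a ∈ NCTorus Ψ := by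
  have hle : NCTorus Θ ≤ (NCTorus Ψ).comap (pullbackProd z h) := by
    refine StarSubalgebra.topologicalClosure_minimal ?_ ?_
    · rw [StarAlgebra.adjoin_le_iff]
      rintro _ ⟨j, rfl⟩
      change pullbackProd z h _ ∈ NCTorus Ψ
      rw [pullbackProd_tautological, ← NCTorus.coe_monomial]
      exact ((z j : ℂ) • (monomial (NCTorus.U Ψ) (fun i => M i j) :
        unitary (NCTorus Ψ)).1 : NCTorus Ψ).2
    · have hc : Continuous (pullbackProd z h) :=
        AddMonoidHomClass.continuous_of_bound (pullbackProd z h) 1 fun a => by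
          rw [one_mul]
          exact NonUnitalStarAlgHom.norm_apply_le (pullbackProd z h) a
      exact (inferInstance : IsClosed (NCTorus Ψ : Set _)).preimage hc
  exact hle a.2

/-- The toric homomorphism `φ_{M,z} : A_Θ → A_Ψ`, with `φ_{M,z}(U_j) = z_j V^{M e_j}`. -/
def toricHom {m n : ℕ} {Θ : Matrix (Fin m) (Fin m) ℝ} {Ψ : Matrix (Fin n) (Fin n) ℝ}
    {M : Matrix (Fin n) (Fin m) ℤ} (z : Fin m → Circle) (h : ToricCongruence Θ Ψ M) :
    NCTorus Θ →⋆ₐ[ℂ] NCTorus Ψ :=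
  StarAlgHom.codRestrict ((pullbackProd z h).comp (NCTorus Θ).subtype) (NCTorus Ψ)
    (pullbackProd_mem z h)

lemma toricHom_U {m n : ℕ} {Θ : Matrix (Fin m) (Fin m) ℝ} {Ψ : Matrix (Fin n) (Fin n) ℝ}
    {M : Matrix (Fin n) (Fin m) ℤ} (z : Fin m → Circle) (h : ToricCongruence Θ Ψ M) (j : Fin m) :
    toricHom z h (NCTorus.U Θ j : NCTorus Θ) =
      (z j : ℂ) • ((monomial (NCTorus.U Ψ) (fun i => M i j) : unitary (NCTorus Ψ)) :
        NCTorus Ψ) := by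
  ext1
  refine (pullbackProd_tautological z h j).trans ?_
  rw [← NCTorus.coe_monomial]
  rfl

/-! ### The left regular representation on `ℓ²(ℤᵐ) ⊗ S` and Fourier multipliers -/

/-- The Hilbert space `ℓ²(G) ⊗ S`, realized as the Hilbert sum of copies of `S` over `G`. -/
abbrev L2 (G S : Type) [NormedAddCommGroup S] : Type := lp (fun _ : G => S) 2

open Classical in
/-- The vector `δ_g ⊗ ξ`. -/
def delta {G S : Type} [NormedAddCommGroup S] (g : G) (ξ : S) : L2 G S := lp.single 2 g ξ

/-- The exponent `∑_{j<k} Θ_{j,k} x_k y_j` of the ordered-monomial cocycle. -/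
def cocycleExponent {m : ℕ} (Θ : Matrix (Fin m) (Fin m) ℝ) (x y : Fin m → ℤ) : ℝ :=
  ∑ j, ∑ k, if j < k then Θ j k * x k * y j else 0

/-- The cocycle `exp(2π i ∑_{j<k} Θ_{j,k} x_k y_j)`, for which `U^x U^y = cocycle x y U^{x+y}`. -/
def cocycle {m : ℕ} (Θ : Matrix (Fin m) (Fin m) ℝ) (x y : Fin m → ℤ) : Circle :=
  e (cocycleExponent Θ x y)

lemma cocycle_add_right {m : ℕ} (Θ : Matrix (Fin m) (Fin m) ℝ) (x y y' : Fin m → ℤ) :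
    cocycle Θ x (y + y') = cocycle Θ x y * cocycle Θ x y' := by
  rw [cocycle, cocycle, cocycle, ← e_add]
  congr 1
  simp only [cocycleExponent, ← Finset.sum_add_distrib]
  refine Finset.sum_congr rfl fun j _ => Finset.sum_congr rfl fun k _ => ?_
  split_ifs
  · push_cast [Pi.add_apply]; ring
  · simp

lemma memℓp_shift {G S : Type} [AddCommGroup G] [NormedAddCommGroup S] [InnerProductSpace ℂ S]
    (p : G → Circle) (a : G) (f : L2 G S) :
    Memℓp (fun y => (p y : ℂ) • f (y - a)) 2 := by
  have hf := (memℓp_gen_iff (by norm_num : 0 < (2 : ℝ≥0∞).toReal)).1 (lp.memℓp f)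
  refine (memℓp_gen_iff (by norm_num)).2 ?_
  simpa [norm_smul, Circle.norm_coe, Function.comp_def] using
    (Equiv.summable_iff (Equiv.subRight a)).2 hf

/-- The operator `(f_y)_y ↦ (p_y f_{y - a})_y` on `ℓ²(G) ⊗ S`. -/
def phasedShift {G S : Type} [AddCommGroup G] [NormedAddCommGroup S] [InnerProductSpace ℂ S]
    (p : G → Circle) (a : G) : L2 G S →ₗᵢ[ℂ] L2 G S where
  toFun f := ⟨fun y => (p y : ℂ) • f (y - a), memℓp_shift p a f⟩
  map_add' f g := by ext y; exact smul_add _ _ _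
  map_smul' c f := by ext y; exact smul_comm _ _ _
  norm_map' f := by
    have h2 : 0 < (2 : ℝ≥0∞).toReal := by norm_num
    rw [lp.norm_eq_tsum_rpow h2, lp.norm_eq_tsum_rpow h2]
    congr 1
    rw [← Equiv.tsum_eq (Equiv.subRight a) (fun y => ‖f y‖ ^ (2 : ℝ≥0∞).toReal)]
    simp [norm_smul, Circle.norm_coe]

/-- The twisted shift `δ_x ⊗ ξ ↦ cocycle a x δ_{a+x} ⊗ ξ`. -/
def twistedShift {m : ℕ} (Θ : Matrix (Fin m) (Fin m) ℝ) (S : Type) [NormedAddCommGroup S]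
    [InnerProductSpace ℂ S] (a : Fin m → ℤ) :
    L2 (Fin m → ℤ) S ≃ₗᵢ[ℂ] L2 (Fin m → ℤ) S :=
  LinearIsometryEquiv.ofSurjective (phasedShift (fun y => cocycle Θ a (y - a)) a) fun g =>
    ⟨phasedShift (fun y => (cocycle Θ a y)⁻¹) (-a) g, by
      ext y
      change (cocycle Θ a (y - a) : ℂ) • ((cocycle Θ a (y - a))⁻¹ : Circle).1 • g (y - a - -a) = g y
      rw [smul_smul, Circle.coe_inv, mul_inv_cancel₀ (Circle.coe_ne_zero _), one_smul]
      simp⟩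

lemma twistedShift_apply {m : ℕ} (Θ : Matrix (Fin m) (Fin m) ℝ) (S : Type) [NormedAddCommGroup S]
    [InnerProductSpace ℂ S] (a : Fin m → ℤ) (f : L2 (Fin m → ℤ) S) (y : Fin m → ℤ) :
    twistedShift Θ S a f y = (cocycle Θ a (y - a) : ℂ) • f (y - a) := rfl

lemma twistedShift_delta {m : ℕ} (Θ : Matrix (Fin m) (Fin m) ℝ) (S : Type) [NormedAddCommGroup S]
    [InnerProductSpace ℂ S] (a x : Fin m → ℤ) (ξ : S) :
    twistedShift Θ S a (delta x ξ) = (cocycle Θ a x : ℂ) • delta (a + x) ξ := by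
  ext y
  rw [twistedShift_apply, lp.coeFn_smul, Pi.smul_apply]
  by_cases h : y = a + x
  · subst h; simp [delta]
  · have h' : y - a ≠ x := fun h' => h (by rw [← h']; abel)
    simp [delta, h, h']

lemma cocycle_single {m : ℕ} {Θ : Matrix (Fin m) (Fin m) ℝ} (hΘ : Θᵀ = -Θ) (j k : Fin m) :
    cocycle Θ (Pi.single k 1) (Pi.single j 1) =
      e (Θ j k) * cocycle Θ (Pi.single j 1) (Pi.single k 1) := by
  have hB : ∀ j k : Fin m, cocycleExponent Θ (Pi.single k 1) (Pi.single j 1) =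
      if j < k then Θ j k else 0 := by
    intro j k
    rw [cocycleExponent, Finset.sum_eq_single j, Finset.sum_eq_single k]
    · simp
    · intro k' _ h; simp [h]
    · simp
    · intro j' _ h; simp [h]
    · simp
  have hs : Θ k j = - Θ j k := by
    have := congrFun (congrFun hΘ j) k
    simpa using this
  rw [cocycle, cocycle, ← e_add, hB, hB]
  congr 1
  rcases lt_trichotomy j k with h | h | h
  · simp [h, h.le.not_gt]
  · subst h
    have : Θ j j = 0 := by linarith
    simp [this]
  · simp [h, h.le.not_gt, hs]

/-- The twisted shifts on `ℓ²(ℤᵐ) ⊗ S` as a model of `A_Θ`. -/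
def regularModel {m : ℕ} {Θ : Matrix (Fin m) (Fin m) ℝ} (hΘ : Θᵀ = -Θ) (S : Type)
    [NormedAddCommGroup S] [InnerProductSpace ℂ S] [CompleteSpace S] [Nontrivial S] :
    TorusModel Θ where
  B := L2 (Fin m → ℤ) S →L[ℂ] L2 (Fin m → ℤ) S
  nontrivial := by
    obtain ⟨ξ, hξ⟩ := exists_ne (0 : S)
    have : Nontrivial (L2 (Fin m → ℤ) S) := by
      refine ⟨delta 0 ξ, 0, fun h => hξ ?_⟩
      have := congrArg (fun f : L2 (Fin m → ℤ) S => f 0) h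
      simpa [delta] using this
    infer_instance
  u j := Unitary.linearIsometryEquiv.symm (twistedShift Θ S (Pi.single j 1))
  rel := by
    intro j k
    ext f : 1
    ext y
    change twistedShift Θ S (Pi.single k 1) (twistedShift Θ S (Pi.single j 1) f) y =
      (e (Θ j k) : ℂ) • twistedShift Θ S (Pi.single j 1) (twistedShift Θ S (Pi.single k 1) f) y
    simp only [twistedShift_apply, smul_smul, ← Circle.coe_mul]
    have hy : y - Pi.single j 1 - Pi.single k 1 = y - Pi.single k 1 - Pi.single j 1 :=
      sub_right_comm _ _ _
    have h1 : y - Pi.single k 1 = (y - Pi.single k 1 - Pi.single j 1) + Pi.single j 1 := by abel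
    have h2 : y - Pi.single j 1 = (y - Pi.single k 1 - Pi.single j 1) + Pi.single k 1 := by abel
    rw [hy, h2, show cocycle Θ (Pi.single k 1) (y - Pi.single k 1) = _ from
      (congrArg _ h1).trans (cocycle_add_right _ _ _ _), cocycle_add_right, cocycle_single hΘ]
    congr 2
    simp only [mul_comm, mul_left_comm, mul_assoc]
    rfl

/-- The left regular representation `π_Θ` of `A_Θ` on `L²(A_Θ, τ_Θ) ⊗ S = ℓ²(ℤᵐ) ⊗ S`, with
`π_Θ(U^a) (δ_x ⊗ ξ) = cocycle a x δ_{a+x} ⊗ ξ`. Here `δ_x` is the GNS vector of the ordered monomial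
`U^x`; the cyclic vector is `δ_0`, and `a ↦ ⟨δ_0, a δ_0⟩` is the canonical trace `τ_Θ`. -/
def regularRep {m : ℕ} {Θ : Matrix (Fin m) (Fin m) ℝ} (hΘ : Θᵀ = -Θ) (S : Type)
    [NormedAddCommGroup S] [InnerProductSpace ℂ S] [CompleteSpace S] [Nontrivial S] :
    NCTorus Θ →⋆ₐ[ℂ] (L2 (Fin m → ℤ) S →L[ℂ] L2 (Fin m → ℤ) S) :=
  NCTorus.lift (regularModel hΘ S)

lemma regularRep_U {m : ℕ} {Θ : Matrix (Fin m) (Fin m) ℝ} (hΘ : Θᵀ = -Θ) (S : Type)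
    [NormedAddCommGroup S] [InnerProductSpace ℂ S] [CompleteSpace S] [Nontrivial S] (j : Fin m)
    (x : Fin m → ℤ) (ξ : S) :
    regularRep hΘ S (NCTorus.U Θ j : NCTorus Θ) (delta x ξ) =
      (cocycle Θ (Pi.single j 1) x : ℂ) • delta (Pi.single j 1 + x) ξ :=
  twistedShift_delta Θ S (Pi.single j 1) x ξ

/-- The diagonal operator `δ_g ⊗ ξ ↦ δ_g ⊗ F(g) ξ` on its maximal domain
`{(ξ_g) : ∑ ‖F(g) ξ_g‖² < ∞}`. -/
def multiplier {G S : Type} [NormedAddCommGroup S] [InnerProductSpace ℂ S] [CompleteSpace S]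
    (F : G → selfAdjoint (S →L[ℂ] S)) : L2 G S →ₗ.[ℂ] L2 G S where
  domain :=
    { carrier := {f | Memℓp (fun g => (F g : S →L[ℂ] S) (f g)) 2}
      zero_mem' := by
        simpa [Pi.zero_def] using (zero_memℓp : Memℓp (0 : G → S) 2)
      add_mem' := by
        intro f g hf hg
        simpa [Pi.add_def] using Memℓp.add hf hg
      smul_mem' := by
        intro c f hf
        simpa [Pi.smul_def] using Memℓp.const_smul hf c }
  toFun :=
    { toFun f := ⟨fun g => (F g : S →L[ℂ] S) (f.1 g), f.2⟩
      map_add' f g := by ext x; exact map_add (F x : S →L[ℂ] S) _ _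
      map_smul' c f := by ext x; exact map_smul (F x : S →L[ℂ] S) _ _ }

/-- For every `R > 0`, the direct sum of one copy of `S` for each `g` with
`Spec F(g) ∩ [-R, R] ≠ ∅` is finite-dimensional. -/
def FiniteSpectralMultiplicity {G S : Type} [NormedAddCommGroup S] [InnerProductSpace ℂ S]
    [CompleteSpace S] (F : G → selfAdjoint (S →L[ℂ] S)) : Prop :=
  ∀ R : ℝ, 0 < R → FiniteDimensional ℂ (DirectSum
    {g : G // ∃ t ∈ Set.Icc (-R) R, (t : ℂ) ∈ spectrum ℂ (F g : S →L[ℂ] S)} fun _ => S)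

/-- For every `h`, `sup_g ‖F(g + h) - F(g)‖ < ∞`. -/
def BoundedTranslationIncrements {G S : Type} [Add G] [NormedAddCommGroup S]
    [InnerProductSpace ℂ S] [CompleteSpace S] (F : G → selfAdjoint (S →L[ℂ] S)) : Prop :=
  ∀ h : G, BddAbove (Set.range fun g => ‖(F (g + h) : S →L[ℂ] S) - (F g : S →L[ℂ] S)‖)

/-! ### Spectral triples -/

/-- `R` is the resolvent `(D - z)⁻¹` of the unbounded operator `D`. -/
def IsResolvent {H : Type*} [NormedAddCommGroup H] [InnerProductSpace ℂ H] (D : H →ₗ.[ℂ] H)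
    (z : ℂ) (R : H →L[ℂ] H) : Prop :=
  (∀ ξ : D.domain, R (D ξ - z • (ξ : H)) = ξ) ∧
    ∀ η : H, ∃ ξ : D.domain, (ξ : H) = R η ∧ D ξ - z • (ξ : H) = η

/-- The resolvent set of `D` is nonempty and all resolvents of `D` are compact. -/
def HasCompactResolvent {H : Type*} [NormedAddCommGroup H] [InnerProductSpace ℂ H]
    (D : H →ₗ.[ℂ] H) : Prop :=
  (∃ z R, IsResolvent D z R) ∧ ∀ z R, IsResolvent D z R → IsCompactOperator R

/-- The elements `a` for which the commutator `[D, π(a)]`, with domain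
`{ξ ∈ Dom D : π(a) ξ ∈ Dom D}`, is densely defined and extends to a bounded operator. -/
def boundedCommutators {A H : Type*} [CStarAlgebra A] [NormedAddCommGroup H]
    [InnerProductSpace ℂ H] [CompleteSpace H] (π : A →⋆ₐ[ℂ] (H →L[ℂ] H)) (D : H →ₗ.[ℂ] H) :
    Set A :=
  {a | Dense {ξ : H | ξ ∈ D.domain ∧ π a ξ ∈ D.domain} ∧
    ∃ C : H →L[ℂ] H, ∀ (ξ : H) (hξ : ξ ∈ D.domain) (hξ' : π a ξ ∈ D.domain),
      C ξ = D ⟨π a ξ, hξ'⟩ - π a (D ⟨ξ, hξ⟩)}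

/-- `(A, H, D)`, with `A` represented on `H` by `π`, is a spectral triple. -/
structure IsSpectralTriple {A H : Type*} [CStarAlgebra A] [NormedAddCommGroup H]
    [InnerProductSpace ℂ H] [CompleteSpace H] (π : A →⋆ₐ[ℂ] (H →L[ℂ] H)) (D : H →ₗ.[ℂ] H) :
    Prop where
  faithful : Function.Injective π
  dense_domain : Dense (D.domain : Set H)
  selfAdjoint : IsSelfAdjoint D
  compactResolvent : HasCompactResolvent D
  dense_boundedCommutators : Dense (boundedCommutators π D)

/-! ### Inductive limits of Hilbert spaces and of unbounded operators -/

section HilbertLimit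

variable {H : ℕ → Type} [∀ n, NormedAddCommGroup (H n)] [∀ n, InnerProductSpace ℂ (H n)]

/-- The isometry `I_{k-1} ∘ ⋯ ∘ I_n : H_n → H_k`. -/
def isometryTransition (I : ∀ n, H n →ₗᵢ[ℂ] H (n + 1)) (n k : ℕ) (h : n ≤ k) :
    H n →ₗᵢ[ℂ] H k :=
  Nat.leRec (motive := fun k _ => H n →ₗᵢ[ℂ] H k) LinearIsometry.id
    (fun k _ f => (I k).comp f) h

lemma isometryTransition_succ (I : ∀ n, H n →ₗᵢ[ℂ] H (n + 1)) (n k : ℕ) (h : n ≤ k)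
    (h' : n ≤ k + 1) :
    isometryTransition I n (k + 1) h' = (I k).comp (isometryTransition I n k h) :=
  Nat.leRec_succ _ _ h

instance isometryTransition_directedSystem (I : ∀ n, H n →ₗᵢ[ℂ] H (n + 1)) :
    DirectedSystem H (isometryTransition I · · ·) where
  map_self n x := by simp [isometryTransition]
  map_map k j i hij hjk x := by
    induction hjk with
    | refl => simp [isometryTransition]
    | @step k hjk ih =>
      have h1 := isometryTransition_succ I j k hjk (Nat.le_succ_of_le hjk)
      have h2 := isometryTransition_succ I i k (hij.trans hjk) (hij.trans (Nat.le_succ_of_le hjk))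
      exact (DFunLike.congr_fun h1 _).trans
        ((congrArg (I k) ih).trans (DFunLike.congr_fun h2 x).symm)

/-- The algebraic direct limit of a sequence of Hilbert spaces and isometries. -/
def PreHilbertLimit (I : ∀ n, H n →ₗᵢ[ℂ] H (n + 1)) : Type :=
  DirectLimit H (isometryTransition I)

variable (I : ∀ n, H n →ₗᵢ[ℂ] H (n + 1))

instance : AddCommGroup (PreHilbertLimit I) :=
  inferInstanceAs (AddCommGroup (DirectLimit H (isometryTransition I)))

instance : Module ℂ (PreHilbertLimit I) :=
  inferInstanceAs (Module ℂ (DirectLimit H (isometryTransition I)))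

/-- The map from a stage into the algebraic direct limit. -/
def toPreHilbertLimit (n : ℕ) : H n →ₗ[ℂ] PreHilbertLimit I where
  toFun x := (⟦⟨n, x⟩⟧ : DirectLimit H (isometryTransition I))
  map_add' x y := (DirectLimit.add_def n x y).symm
  map_smul' c x := (DirectLimit.smul_def n x c).symm

/-- The inner product on the algebraic direct limit, computed at any common stage. -/
@[reducible]
def preHilbertLimitCore : InnerProductSpace.Core ℂ (PreHilbertLimit I) where
  inner x y := DirectLimit.lift₂ (isometryTransition I) (isometryTransition I)
    (fun _ x y => inner ℂ x y)
    (fun i j h x y => ((isometryTransition I i j h).inner_map_map x y).symm) x y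
  conj_inner_symm := DirectLimit.induction₂ _ fun i x y => by
    rw [DirectLimit.lift₂_def, DirectLimit.lift₂_def, inner_conj_symm]
  re_inner_nonneg := DirectLimit.induction _ fun i x => by
    rw [DirectLimit.lift₂_def]
    exact inner_self_nonneg
  add_left := DirectLimit.induction₃ _ fun i x y z => by
    erw [DirectLimit.add_def, DirectLimit.lift₂_def, DirectLimit.lift₂_def, DirectLimit.lift₂_def,
      inner_add_left]
  smul_left := fun x y r => DirectLimit.induction₂ _ (fun i x y => by
    erw [DirectLimit.smul_def, DirectLimit.lift₂_def, DirectLimit.lift₂_def, inner_smul_left]) x y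
  definite := DirectLimit.induction _ fun i x h => by
    rw [DirectLimit.lift₂_def, inner_self_eq_zero] at h
    rw [h]
    exact (DirectLimit.zero_def i).symm

instance : NormedAddCommGroup (PreHilbertLimit I) :=
  (preHilbertLimitCore I).toNormedAddCommGroup

instance : InnerProductSpace ℂ (PreHilbertLimit I) :=
  InnerProductSpace.ofCore (preHilbertLimitCore I).toCore

lemma inner_toPreHilbertLimit (n : ℕ) (x y : H n) :
    inner ℂ (toPreHilbertLimit I n x) (toPreHilbertLimit I n y) = inner ℂ x y :=
  DirectLimit.lift₂_def (isometryTransition I) (isometryTransition I)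
    (fun _ x y => inner ℂ x y)
    (fun i j h x y => ((isometryTransition I i j h).inner_map_map x y).symm) n x y

lemma norm_toPreHilbertLimit (n : ℕ) (x : H n) : ‖toPreHilbertLimit I n x‖ = ‖x‖ := by
  rw [norm_eq_sqrt_re_inner (𝕜 := ℂ), inner_toPreHilbertLimit, ← norm_eq_sqrt_re_inner]

/-- The Hilbert space inductive limit. -/
abbrev HilbertLimit : Type := UniformSpace.Completion (PreHilbertLimit I)

/-- The canonical isometries into the Hilbert space inductive limit. -/
def toHilbertLimit (n : ℕ) : H n →ₗᵢ[ℂ] HilbertLimit I :=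
  UniformSpace.Completion.toComplₗᵢ.comp
    { toPreHilbertLimit I n with norm_map' := norm_toPreHilbertLimit I n }

/-- The union of the graphs of the operators `j_n D_n j_n⁻¹`, that is, the graph of
`j_n ξ ↦ j_n (D_n ξ)` for `ξ ∈ Dom D_n`. -/
def limitGraph (D : ∀ n, H n →ₗ.[ℂ] H n) : Submodule ℂ (HilbertLimit I × HilbertLimit I) :=
  ⨆ n, (D n).graph.map
    ((toHilbertLimit I n).toLinearMap.prodMap (toHilbertLimit I n).toLinearMap)

/-- The operator `j_n ξ ↦ j_n (D_n ξ)` on the core `⋃_n j_n (Dom D_n)`. -/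
def limitCoreOperator (D : ∀ n, H n →ₗ.[ℂ] H n) : HilbertLimit I →ₗ.[ℂ] HilbertLimit I :=
  (limitGraph I D).toLinearPMap

/-- The inductive limit of the operators `D_n`: the closure of `limitCoreOperator`. -/
def limitOperator (D : ∀ n, H n →ₗ.[ℂ] H n) : HilbertLimit I →ₗ.[ℂ] HilbertLimit I :=
  (limitCoreOperator I D).closure

/-- The construction of `limitOperator` is legitimate: the prescription `j_n ξ ↦ j_n (D_n ξ)` is
single-valued, densely defined and closable. -/
def LimitOperatorWellDefined (D : ∀ n, H n →ₗ.[ℂ] H n) : Prop :=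
  (limitCoreOperator I D).graph = limitGraph I D ∧
    Dense ((limitCoreOperator I D).domain : Set (HilbertLimit I)) ∧
    (limitCoreOperator I D).IsClosable

end HilbertLimit

/-! ### Inductive limits of C⋆-algebras -/

section CStarLimit

variable {A : ℕ → Type*} [∀ n, CStarAlgebra (A n)]

/-- A nonzero unital C⋆-algebra with compatible unital ⋆-homomorphisms from the `A_n`. -/
structure CStarCocone (φ : ∀ n, A n →⋆ₐ[ℂ] A (n + 1)) where
  B : Type
  [cstar : CStarAlgebra B]
  [nontrivial : Nontrivial B]
  ψ : ∀ n, A n →⋆ₐ[ℂ] B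
  compat : ∀ n a, ψ (n + 1) (φ n a) = ψ n a

attribute [instance] CStarCocone.cstar CStarCocone.nontrivial

variable (φ : ∀ n, A n →⋆ₐ[ℂ] A (n + 1))

/-- All the maps from `A_n` into cocones, as one map into the product of all cocones. -/
def toCoconeProd (n : ℕ) : A n →⋆ₐ[ℂ] lp (fun c : CStarCocone φ => c.B) ∞ where
  toFun a := ⟨fun c => c.ψ n a, memℓp_infty ⟨‖a‖, by
    rintro _ ⟨c, rfl⟩
    exact NonUnitalStarAlgHom.norm_apply_le (c.ψ n) a⟩⟩
  map_one' := by ext c; exact map_one _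
  map_mul' a b := by ext c; exact map_mul _ _ _
  map_zero' := by ext c; exact map_zero _
  map_add' a b := by ext c; exact map_add _ _ _
  commutes' r := by ext c; exact AlgHomClass.commutes (c.ψ n) r
  map_star' a := by ext c; exact map_star _ _

/-- The inductive limit `lim (A_n, φ_n)` of a sequence of unital C⋆-algebras, as the closure of the
union of the images of the `A_n` in the product of all cocones; it is the universal cocone.
(Cocones in `Type` suffice when the `A_n` are separable, as the noncommutative tori are: a
separable C⋆-algebra is isomorphic to one in `Type`.) -/
def CStarLimit : StarSubalgebra ℂ (lp (fun c : CStarCocone φ => c.B) ∞) :=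
  (⨆ n, (toCoconeProd φ n).range).topologicalClosure

instance : IsClosed (CStarLimit φ : Set (lp (fun c : CStarCocone φ => c.B) ∞)) :=
  StarSubalgebra.isClosed_topologicalClosure _

/-- The canonical maps into the inductive limit. -/
def toCStarLimit (n : ℕ) : A n →⋆ₐ[ℂ] CStarLimit φ :=
  StarAlgHom.codRestrict (toCoconeProd φ n) (CStarLimit φ) fun a =>
    StarSubalgebra.le_topologicalClosure _
      (le_iSup (fun n => (toCoconeProd φ n).range) n ⟨a, rfl⟩)

lemma toCStarLimit_comp (n : ℕ) (a : A n) :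
    toCStarLimit φ (n + 1) (φ n a) = toCStarLimit φ n a := by
  ext c
  exact c.compat n a

end CStarLimit

/-! ### Unital toric inductive systems -/

/-- `Θ` is nondegenerate: only `x = 0` satisfies `exp(2π i ⟨x, Θ y⟩) = 1` for all `y ∈ ℤᵐ`. -/
def Nondegenerate {m : ℕ} (Θ : Matrix (Fin m) (Fin m) ℝ) : Prop :=
  ∀ x : Fin m → ℤ,
    (∀ y : Fin m → ℤ, e ((fun j => (x j : ℝ)) ⬝ᵥ (Θ *ᵥ fun k => (y k : ℝ))) = 1) → x = 0

/-- The data of a unital toric inductive system of simple noncommutative tori. -/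
structure ToricSystem where
  m : ℕ → ℕ
  Θ : ∀ n, Matrix (Fin (m n)) (Fin (m n)) ℝ
  skew : ∀ n, (Θ n)ᵀ = -Θ n
  nondegenerate : ∀ n, Nondegenerate (Θ n)
  M : ∀ n, Matrix (Fin (m (n + 1))) (Fin (m n)) ℤ
  z : ∀ n, Fin (m n) → Circle
  congruence : ∀ n, ToricCongruence (Θ n) (Θ (n + 1)) (M n)

namespace ToricSystem

variable (T : ToricSystem)

/-- The lattice `ℤ^{m_n}` of Fourier labels. -/
abbrev Label (n : ℕ) : Type := Fin (T.m n) → ℤ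

/-- The noncommutative torus `A_n = A_{Θ_n}`. -/
abbrev A (n : ℕ) : Type 1 := NCTorus (T.Θ n)

/-- The connecting map `φ_n = φ_{M_n, z_n} : A_n → A_{n+1}`. -/
def φ (n : ℕ) : T.A n →⋆ₐ[ℂ] T.A (n + 1) := toricHom (T.z n) (T.congruence n)

/-- The matrix product `M_{k-1} ⋯ M_n` as a map `ℤ^{m_n} → ℤ^{m_k}`. -/
def labelTransition (n k : ℕ) (h : n ≤ k) : T.Label n →ₗ[ℤ] T.Label k :=
  Nat.leRec (motive := fun k _ => T.Label n →ₗ[ℤ] T.Label k) LinearMap.id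
    (fun k _ f => (T.M k).mulVecLin ∘ₗ f) h

lemma labelTransition_succ (n k : ℕ) (h : n ≤ k) (h' : n ≤ k + 1) :
    T.labelTransition n (k + 1) h' = (T.M k).mulVecLin ∘ₗ T.labelTransition n k h :=
  Nat.leRec_succ _ _ h

instance labelTransition_directedSystem : DirectedSystem T.Label (T.labelTransition · · ·) where
  map_self n x := by simp [labelTransition]
  map_map k j i hij hjk x := by
    induction hjk with
    | refl => simp [labelTransition]
    | @step k hjk ih =>
      have h1 := T.labelTransition_succ j k hjk (Nat.le_succ_of_le hjk)
      have h2 := T.labelTransition_succ i k (hij.trans hjk) (hij.trans (Nat.le_succ_of_le hjk))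
      exact (DFunLike.congr_fun h1 _).trans
        ((congrArg (T.M k).mulVecLin ih).trans (DFunLike.congr_fun h2 x).symm)

/-- The label group `G_∞ = lim (ℤ^{m_n}, M_n)`. -/
abbrev G : Type := DirectLimit T.Label T.labelTransition

/-- The class `[x, n] ∈ G_∞` of `x ∈ ℤ^{m_n}`. -/
def label (n : ℕ) (x : T.Label n) : T.G := ⟦⟨n, x⟩⟧

variable (S : Type) [NormedAddCommGroup S] [InnerProductSpace ℂ S] [CompleteSpace S] [Nontrivial S]

/-- The Hilbert space `H_n = L²(A_n, τ_n) ⊗ S = ℓ²(ℤ^{m_n}) ⊗ S`. -/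
abbrev H (S : Type) [NormedAddCommGroup S] (n : ℕ) : Type := L2 (T.Label n) S

/-- The representation `π_n` of `A_n` on `H_n`. -/
def π (n : ℕ) : T.A n →⋆ₐ[ℂ] (T.H S n →L[ℂ] T.H S n) := regularRep (T.skew n) S

variable {S}

/-- The vector `Λ_n(a) ⊗ ξ ∈ H_n`, where `Λ_n(a) = π_n(a) δ_0` is the GNS vector of `a`. -/
def Λ (n : ℕ) (a : T.A n) (ξ : S) : T.H S n := T.π S n a (delta 0 ξ)

/-- The isometries `I_n : H_n → H_{n+1}` are those induced by the connecting maps,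
`I_n (Λ_n(a) ⊗ ξ) = Λ_{n+1}(φ_n(a)) ⊗ ξ`. -/
def IsGNSIsometry (I : ∀ n, T.H S n →ₗᵢ[ℂ] T.H S (n + 1)) : Prop :=
  ∀ n (a : T.A n) (ξ : S), I n (T.Λ n a ξ) = T.Λ (n + 1) (T.φ n a) ξ

/-- The protoral C⋆-algebra `A_pro = lim (A_n, φ_n)`. -/
abbrev Apro : Type 1 := CStarLimit T.φ

/-- The representation `π` of `A_pro = lim A_n` on `H_pro = lim H_n` is the one induced by the
representations `π_n`, that is, `π(ι_n(a)) j_n = j_n π_n(a)`. -/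
def IsLimitRep (I : ∀ n, T.H S n →ₗᵢ[ℂ] T.H S (n + 1))
    (π : T.Apro →⋆ₐ[ℂ] (HilbertLimit I →L[ℂ] HilbertLimit I)) : Prop :=
  ∀ n (a : T.A n) (η : T.H S n),
    π (toCStarLimit T.φ n a) (toHilbertLimit I n η) = toHilbertLimit I n (T.π S n a η)

end ToricSystem

end Protorus

end

/-!
Everything is diagonal in the label basis up to phases. A connecting map `φ_n` sends the monomial
`U^x` to a phase times `V^{M_n x}`, so `I_n` sends `δ_x ⊗ ξ` to a phase times `δ_{M_n x} ⊗ ξ`. The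
nondegeneracy of `Θ_n` makes `M_n` injective, so the vectors `δ_x ⊗ ξ` of all stages become, up to
phases, the standard basis of `ℓ²(G_∞) ⊗ S`. This is the unitary `V`; phases commute with diagonal
operators, so `V` turns `D_pro` into `D_{F_∞}`.

In `ℓ²(G_∞) ⊗ S` the element `ι_n(U^x)` acts as a translation by `[x, n]` up to phases, and its
commutator with `D_{F_∞}` is such a translation composed with `F_∞(g + [x, n]) - F_∞(g)`, bounded by
(b). Compactness of the resolvent is (a), and faithfulness passes from the stages to the limit.

At a stage, faithfulness of the regular representation is that of the trace: averaging `a⋆a` over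
the gauge action of `𝕋ᵐ` gives the scalar `τ(a⋆a)`, and the average of a nonzero positive element
is nonzero.
-/

open scoped ENNReal Matrix

noncomputable section

namespace Protorus

/-! ### Vectors of `ℓ²(G) ⊗ S` and phased pushforwards -/

section Delta

variable {G G' G'' S : Type} [NormedAddCommGroup S]

lemma delta_apply_self (g : G) (ξ : S) : (delta g ξ : L2 G S) g = ξ := by
  simp [delta]

lemma delta_apply_ne {g h : G} (ξ : S) (hgh : h ≠ g) : (delta g ξ : L2 G S) h = 0 := by
  simp [delta, hgh]

lemma norm_delta (g : G) (ξ : S) : ‖(delta g ξ : L2 G S)‖ = ‖ξ‖ := by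
  classical
  exact lp.norm_single (E := fun _ : G => S) two_pos g ξ

lemma hasSum_delta (f : L2 G S) : HasSum (fun g => (delta g (f g) : L2 G S)) f := by
  classical
  exact lp.hasSum_single (E := fun _ : G => S) (p := 2) ENNReal.ofNat_ne_top f

variable [InnerProductSpace ℂ S]

open Classical in
variable (S) in
/-- The isometric embedding `ξ ↦ δ_g ⊗ ξ` of `S` into `ℓ²(G) ⊗ S`. -/
def deltaIsometry (g : G) : S →ₗᵢ[ℂ] L2 G S :=
  { lp.lsingle (E := fun _ : G => S) 2 g with norm_map' := norm_delta g }

lemma inner_delta_left (g : G) (ξ : S) (f : L2 G S) :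
    inner ℂ (delta g ξ) f = inner ℂ ξ (f g) := by
  classical
  exact lp.inner_single_left (G := fun _ : G => S) g ξ f

lemma inner_delta_of_ne {g h : G} (hgh : g ≠ h) (ξ η : S) :
    inner ℂ (delta g ξ : L2 G S) (delta h η) = 0 := by
  rw [inner_delta_left, delta_apply_ne _ hgh, inner_zero_right]

lemma mem_of_forall_delta_mem {K : Submodule ℂ (L2 G S)} (hK : IsClosed (K : Set (L2 G S)))
    (h : ∀ g ξ, delta g ξ ∈ K) (f : L2 G S) : f ∈ K :=
  hK.mem_of_tendsto (hasSum_delta f)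
    (Filter.Eventually.of_forall fun _ => K.sum_mem fun g _ => h g (f g))

lemma ext_delta {E : Type*} [NormedAddCommGroup E] [NormedSpace ℂ E] {T T' : L2 G S →L[ℂ] E}
    (h : ∀ g ξ, T (delta g ξ) = T' (delta g ξ)) : T = T' := by
  classical
  exact lp.ext_continuousLinearMap ENNReal.ofNat_ne_top fun g => ContinuousLinearMap.ext (h g)

/-- `W` maps `δ_x ⊗ ξ` to `δ_{f x} ⊗ ξ`, up to a phase that depends on `x` only. -/
def IsPhasedPushforward (f : G → G') (W : L2 G S →L[ℂ] L2 G' S) : Prop :=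
  ∀ x, ∃ c : Circle, ∀ ξ, W (delta x ξ) = (c : ℂ) • delta (f x) ξ

namespace IsPhasedPushforward

variable {f : G → G'} {W : L2 G S →L[ℂ] L2 G' S}

lemma comp {f' : G' → G''} {W' : L2 G' S →L[ℂ] L2 G'' S} (hW' : IsPhasedPushforward f' W')
    (hW : IsPhasedPushforward f W) : IsPhasedPushforward (f' ∘ f) (W' ∘L W) := by
  intro x
  obtain ⟨c, hc⟩ := hW x
  obtain ⟨c', hc'⟩ := hW' (f x)
  refine ⟨c * c', fun ξ => ?_⟩
  simp only [ContinuousLinearMap.comp_apply, hc, hc', map_smul, smul_smul, Circle.coe_mul,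
    Function.comp_apply]

lemma exists_phase_apply (hW : IsPhasedPushforward f W) (hf : Function.Injective f) (x : G) :
    ∃ c : Circle, ∀ η, W η (f x) = (c : ℂ) • η x := by
  obtain ⟨c, hc⟩ := hW x
  refine ⟨c, DFunLike.congr_fun (f := lp.evalCLM ℂ (fun _ : G' => S) 2 (f x) ∘L W)
    (g := (c : ℂ) • lp.evalCLM ℂ (fun _ : G => S) 2 x) (ext_delta fun y ξ => ?_)⟩
  change W (delta y ξ) (f x) = (c : ℂ) • (delta y ξ : L2 G S) x
  obtain rfl | hxy := eq_or_ne x y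
  · rw [hc, lp.coeFn_smul, Pi.smul_apply, delta_apply_self, delta_apply_self]
  · obtain ⟨c', hc'⟩ := hW y
    rw [hc', lp.coeFn_smul, Pi.smul_apply, delta_apply_ne _ hxy, delta_apply_ne _ (hf.ne hxy),
      smul_zero, smul_zero]

lemma apply_of_notMem_range (hW : IsPhasedPushforward f W) {y : G'} (hy : y ∉ Set.range f)
    (η : L2 G S) : W η y = 0 := by
  refine DFunLike.congr_fun (f := lp.evalCLM ℂ (fun _ : G' => S) 2 y ∘L W) (g := 0)
    (ext_delta fun x ξ => ?_) η
  obtain ⟨c, hc⟩ := hW x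
  change W (delta x ξ) y = 0
  rw [hc, lp.coeFn_smul, Pi.smul_apply, delta_apply_ne _ (fun h => hy ⟨x, h.symm⟩), smul_zero]

end IsPhasedPushforward

/-- The isometry `ξ ↦ c δ_g ⊗ ξ` for a phase `c`. -/
def phasedDeltaIsometry (c : Circle) (g : G) : S →ₗᵢ[ℂ] L2 G S where
  toLinearMap := (c : ℂ) • (deltaIsometry S g).toLinearMap
  norm_map' ξ := by
    change ‖(c : ℂ) • delta g ξ‖ = ‖ξ‖
    rw [norm_smul, Circle.norm_coe, one_mul, norm_delta]

lemma orthogonalFamily_phasedDeltaIsometry {f : G → G'} (hf : Function.Injective f)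
    (c : G → Circle) :
    OrthogonalFamily ℂ (fun _ : G => S) fun x => phasedDeltaIsometry (c x) (f x) := by
  intro x y hxy ξ η
  change inner ℂ ((c x : ℂ) • delta (f x) ξ) ((c y : ℂ) • delta (f y) η) = 0
  rw [inner_smul_left, inner_smul_right, inner_delta_of_ne (hf.ne hxy), mul_zero, mul_zero]

lemma exists_isometry_delta [CompleteSpace S] {f : G → G'} (hf : Function.Injective f)
    (c : G → Circle) :
    ∃ I : L2 G S →ₗᵢ[ℂ] L2 G' S, ∀ x ξ, I (delta x ξ) = (c x : ℂ) • delta (f x) ξ := by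
  classical
  have h := orthogonalFamily_phasedDeltaIsometry (S := S) hf c
  refine ⟨h.linearIsometry, fun x ξ => Eq.trans ?_ (h.linearIsometry_apply_single ξ)⟩
  unfold delta
  congr!

end Delta

/-! ### Ordered monomials -/

section Monomial

variable {m n : ℕ}

lemma monomial_eq_prod {C : Type*} [CommGroup C] (u : Fin m → C) (x : Fin m → ℤ) :
    monomial u x = ∏ i, u i ^ x i := by
  simp [monomial, List.prod_ofFn]

lemma monomial_zero {Q : Type*} [Group Q] (u : Fin m → Q) : monomial u 0 = 1 := by
  simp [monomial]

lemma monomial_single {Q : Type*} [Group Q] (u : Fin m → Q) (j : Fin m) :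
    monomial u (Pi.single j 1) = u j := by
  rw [monomial, List.ofFn_eq_map, List.prod_map_eq_pow_single j]
  · simp [List.count_eq_one_of_mem (List.nodup_finRange m) (List.mem_finRange j)]
  · intro i hij _
    simp [hij]

lemma monomial_map_single {Q : Type*} [Group Q] (f : Multiplicative (Fin m → ℤ) →* Q)
    (x : Fin m → ℤ) :
    monomial (fun j => f (Multiplicative.ofAdd (Pi.single j 1))) x =
      f (Multiplicative.ofAdd x) := by
  rw [← map_monomial, monomial_eq_prod]
  congr 1
  simp_rw [← ofAdd_zsmul, ← ofAdd_sum, ← Pi.single_smul, smul_eq_mul, mul_one,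
    Finset.univ_sum_single]

lemma exists_commGroup_lift.{u} {Q : Type u} [Group Q] (v : Fin m → Q)
    (hv : ∀ i j, v i * v j = v j * v i) :
    ∃ (C : Type u) (_ : CommGroup C) (f : C →* Q) (w : Fin m → C), ∀ i, f (w i) = v i := by
  have hcomm : IsMulCommutative (Subgroup.closure (Set.range v)) :=
    Subgroup.isMulCommutative_closure (by rintro _ ⟨i, rfl⟩ _ ⟨j, rfl⟩; exact hv i j)
  exact ⟨Subgroup.closure (Set.range v),
    { (inferInstance : Group (Subgroup.closure (Set.range v))) with mul_comm := hcomm.1.1 },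
    (Subgroup.closure (Set.range v)).subtype, fun i => ⟨v i, Subgroup.subset_closure ⟨i, rfl⟩⟩,
    fun i => rfl⟩

lemma monomial_add_of_comm {Q : Type*} [Group Q] {v : Fin m → Q}
    (hv : ∀ i j, v i * v j = v j * v i) (x y : Fin m → ℤ) :
    monomial v (x + y) = monomial v x * monomial v y := by
  obtain ⟨C, _, f, w, hw⟩ := exists_commGroup_lift v hv
  obtain rfl : (fun i => f (w i)) = v := funext hw
  simp only [← map_monomial, ← map_mul, monomial_eq_prod, Pi.add_apply, zpow_add,
    Finset.prod_mul_distrib]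

lemma monomial_neg_of_comm {Q : Type*} [Group Q] {v : Fin m → Q}
    (hv : ∀ i j, v i * v j = v j * v i) (x : Fin m → ℤ) :
    monomial v (-x) = (monomial v x)⁻¹ := by
  rw [eq_inv_iff_mul_eq_one, ← monomial_add_of_comm hv, neg_add_cancel, monomial_zero]

lemma monomial_mulVec_of_comm {Q : Type*} [Group Q] {v : Fin n → Q}
    (hv : ∀ i j, v i * v j = v j * v i) (M : Matrix (Fin n) (Fin m) ℤ) (x : Fin m → ℤ) :
    monomial (fun j => monomial v fun i => M i j) x = monomial v (M *ᵥ x) := by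
  obtain ⟨C, _, f, w, hw⟩ := exists_commGroup_lift v hv
  obtain rfl : (fun i => f (w i)) = v := funext hw
  simp only [← map_monomial]
  congr 1
  simp only [monomial_eq_prod, ← Finset.prod_zpow, ← zpow_mul]
  rw [Finset.prod_comm]
  refine Finset.prod_congr rfl fun i _ => ?_
  exact (map_sum (zmultiplesHom (Additive C) (Additive.ofMul (w i))) _ _).symm

end Monomial

/-! ### Unitaries modulo scalars -/

section Projective

variable {B : Type*} [CStarAlgebra B]

instance normal_range_scalarUnitary : (scalarUnitary B).range.Normal where
  conj_mem := by
    rintro _ ⟨z, rfl⟩ g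
    rw [← scalarUnitary_comm, mul_inv_cancel_right]
    exact ⟨z, rfl⟩

variable (B) in
/-- The unitary group of `B` modulo the scalars. Monomials in the generators of a noncommutative
torus commute here, so that phases need not be computed. -/
abbrev ProjectiveUnitary : Type _ := unitary B ⧸ (scalarUnitary B).range

variable (B) in
/-- The quotient map onto the projective unitary group. -/
abbrev toProjective : unitary B →* ProjectiveUnitary B :=
  QuotientGroup.mk' (scalarUnitary B).range

lemma coe_scalarUnitary_mul (z : Circle) (b : unitary B) :
    ((scalarUnitary B z * b : unitary B) : B) = (z : ℂ) • (b : B) :=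
  (Algebra.smul_def _ _).symm

lemma toProjective_scalarUnitary (z : Circle) : toProjective B (scalarUnitary B z) = 1 :=
  (QuotientGroup.eq_one_iff _).2 ⟨z, rfl⟩

lemma toProjective_eq_iff {a b : unitary B} :
    toProjective B a = toProjective B b ↔ ∃ z : Circle, (a : B) = (z : ℂ) • (b : B) := by
  constructor
  · intro h
    obtain ⟨z, hz⟩ := QuotientGroup.eq.1 h.symm
    exact ⟨z, by rw [← coe_scalarUnitary_mul, scalarUnitary_comm, hz, mul_inv_cancel_left]⟩
  · rintro ⟨z, hz⟩
    rw [← coe_scalarUnitary_mul] at hz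
    rw [Subtype.ext hz, map_mul, toProjective_scalarUnitary, one_mul]

namespace TorusRelations

variable {m n : ℕ} {Θ : Matrix (Fin m) (Fin m) ℝ} {u : Fin m → unitary B}

lemma toProjective_comm (h : TorusRelations Θ u) (i j : Fin m) :
    toProjective B (u i) * toProjective B (u j) = toProjective B (u j) * toProjective B (u i) := by
  rw [← map_mul, TorusRelations.group.1 h j i, map_mul, toProjective_scalarUnitary, one_mul,
    map_mul]

lemma exists_monomial_mul (h : TorusRelations Θ u) (x y : Fin m → ℤ) :
    ∃ z : Circle, ((monomial u x : unitary B) * (monomial u y : unitary B) : B) =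
      (z : ℂ) • ((monomial u (x + y) : unitary B) : B) := by
  refine (toProjective_eq_iff (a := monomial u x * monomial u y)).1 ?_
  rw [map_mul, map_monomial, map_monomial, map_monomial, monomial_add_of_comm h.toProjective_comm]

lemma exists_star_monomial (h : TorusRelations Θ u) (x : Fin m → ℤ) :
    ∃ z : Circle, star ((monomial u x : unitary B) : B) =
      (z : ℂ) • ((monomial u (-x) : unitary B) : B) := by
  refine (toProjective_eq_iff (a := (monomial u x)⁻¹)).1 ?_
  rw [map_inv, map_monomial, map_monomial, monomial_neg_of_comm h.toProjective_comm]

/-- The monoid of the products of phases and ordered monomials. -/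
def phasedMonomials (h : TorusRelations Θ u) : Submonoid B where
  carrier := {b | ∃ (z : Circle) (x : Fin m → ℤ), b = (z : ℂ) • ((monomial u x : unitary B) : B)}
  one_mem' := ⟨1, 0, by simp [monomial_zero]⟩
  mul_mem' := by
    rintro _ _ ⟨z, x, rfl⟩ ⟨w, y, rfl⟩
    obtain ⟨c, hc⟩ := h.exists_monomial_mul x y
    exact ⟨z * w * c, x + y, by simp only [smul_mul_smul_comm, hc, smul_smul, Circle.coe_mul]⟩

lemma adjoin_le_span (h : TorusRelations Θ u) :
    Subalgebra.toSubmodule (StarAlgebra.adjoin ℂ (Set.range fun j => (u j : B))).toSubalgebra ≤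
      Submodule.span ℂ (Set.range fun x => ((monomial u x : unitary B) : B)) := by
  have hgen : Set.range (fun j => (u j : B)) ∪ star (Set.range fun j => (u j : B)) ⊆
      h.phasedMonomials := by
    rintro b (⟨j, rfl⟩ | hb)
    · exact ⟨1, Pi.single j 1, by rw [monomial_single, Circle.coe_one, one_smul]⟩
    · obtain ⟨j, hj⟩ := Set.mem_star.1 hb
      obtain ⟨z, hz⟩ := h.exists_star_monomial (Pi.single j 1)
      rw [monomial_single] at hz
      exact ⟨z, -Pi.single j 1, by rw [← hz, ← star_star b, ← hj]⟩
  rw [StarAlgebra.adjoin_eq_span, Submodule.span_le]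
  intro b hb
  obtain ⟨z, x, rfl⟩ := Submonoid.closure_le.2 hgen hb
  exact Submodule.smul_mem _ _ (Submodule.subset_span ⟨x, rfl⟩)

lemma exists_map_monomial {A : Type*} [CStarAlgebra A] (h : TorusRelations Θ u)
    (v : Fin n → unitary A) (M : Matrix (Fin m) (Fin n) ℤ) (z : Fin n → Circle) (f : A →⋆ₐ[ℂ] B)
    (hf : ∀ j, f (v j : A) = (z j : ℂ) • ((monomial u fun i => M i j : unitary B) : B))
    (x : Fin n → ℤ) :
    ∃ c : Circle, f ((monomial v x : unitary A) : A) =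
      (c : ℂ) • ((monomial u (M *ᵥ x) : unitary B) : B) := by
  refine (toProjective_eq_iff (a := unitaryMap f (monomial v x))).1 ?_
  have hproj (j : Fin n) : toProjective B (unitaryMap f (v j)) =
      monomial (fun i => toProjective B (u i)) fun i => M i j := by
    rw [← map_monomial, toProjective_eq_iff]
    exact ⟨z j, hf j⟩
  simp_rw [map_monomial, hproj, monomial_mulVec_of_comm h.toProjective_comm]

end TorusRelations

lemma monomial_scalarUnitary_mul {m : ℕ} (t : Fin m → Circle) (u : Fin m → unitary B)
    (x : Fin m → ℤ) :
    monomial (fun j => scalarUnitary B (t j) * u j) x =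
      scalarUnitary B (monomial t x) * monomial u x := by
  let f : Circle × unitary B →* unitary B :=
    (scalarUnitary B).noncommCoprod (MonoidHom.id _) fun z b => scalarUnitary_comm z b
  have hfst := map_monomial (MonoidHom.fst Circle (unitary B)) (fun j => (t j, u j)) x
  have hsnd := map_monomial (MonoidHom.snd Circle (unitary B)) (fun j => (t j, u j)) x
  exact (map_monomial f (fun j => (t j, u j)) x).symm.trans
    (congrArg₂ (fun a b => scalarUnitary B a * b) hfst hsnd)

lemma map_monomial_of_map_eq_smul {A : Type*} [CStarAlgebra A] {m : ℕ} (v : Fin m → unitary A)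
    (u : Fin m → unitary B) (f : A →⋆ₐ[ℂ] B) (t : Fin m → Circle)
    (hf : ∀ j, f (v j : A) = (t j : ℂ) • (u j : B)) (x : Fin m → ℤ) :
    f ((monomial v x : unitary A) : A) =
      ((monomial t x : Circle) : ℂ) • ((monomial u x : unitary B) : B) := by
  have hgen : (fun j => unitaryMap f (v j)) = fun j => scalarUnitary B (t j) * u j :=
    funext fun j => Subtype.ext ((hf j).trans (coe_scalarUnitary_mul (t j) (u j)).symm)
  have hmono : unitaryMap f (monomial v x) = scalarUnitary B (monomial t x) * monomial u x := by
    rw [map_monomial, hgen, monomial_scalarUnitary_mul]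
  exact (congrArg Subtype.val hmono).trans (coe_scalarUnitary_mul _ _)

end Projective

/-! ### Ordered monomials in the noncommutative torus -/

namespace NCTorus

variable {m : ℕ} (Θ : Matrix (Fin m) (Fin m) ℝ)

lemma torusRelations_tautologicalUnitary : TorusRelations Θ (tautologicalUnitary Θ) := by
  intro j k
  ext r
  exact r.rel j k

lemma torusRelations : TorusRelations Θ (NCTorus.U Θ) := fun j k =>
  Subtype.ext (torusRelations_tautologicalUnitary Θ j k)

/-- The ordered monomial `U^x` as an element of `A_Θ`. -/
def mono (x : Fin m → ℤ) : NCTorus Θ := (monomial (NCTorus.U Θ) x : unitary (NCTorus Θ))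

lemma mono_zero : mono Θ 0 = 1 := by
  rw [mono, monomial_zero, OneMemClass.coe_one]

lemma dense_span_mono : Dense (Submodule.span ℂ (Set.range (mono Θ)) : Set (NCTorus Θ)) := by
  intro a
  have himage : (NCTorus Θ).subtype '' (Submodule.span ℂ (Set.range (mono Θ)) : Set (NCTorus Θ)) =
      Submodule.span ℂ (Set.range fun x => ((monomial (tautologicalUnitary Θ) x :
        unitary (lp (fun r : TorusModel Θ => r.B) ∞)) : lp (fun r : TorusModel Θ => r.B) ∞)) := by
    simp_rw [← NCTorus.coe_monomial]
    rw [Set.range_comp' Subtype.val]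
    exact congrArg SetLike.coe (Submodule.map_span (NCTorus Θ).subtype.toLinearMap _)
  rw [Topology.IsInducing.subtypeVal.closure_eq_preimage_closure_image]
  refine closure_mono ?_ a.2
  exact fun b hb => himage.ge ((torusRelations_tautologicalUnitary Θ).adjoin_le_span hb)

variable {Θ}

lemma ext_mono {E : Type*} [NormedAddCommGroup E] [NormedSpace ℂ E] {f g : NCTorus Θ →L[ℂ] E}
    (h : ∀ x, f (mono Θ x) = g (mono Θ x)) : f = g :=
  ContinuousLinearMap.ext_on (dense_span_mono Θ) (by rintro _ ⟨x, rfl⟩; exact h x)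

end NCTorus

lemma exists_toricHom_mono {m n : ℕ} {Θ : Matrix (Fin m) (Fin m) ℝ}
    {Ψ : Matrix (Fin n) (Fin n) ℝ} {M : Matrix (Fin n) (Fin m) ℤ} (z : Fin m → Circle)
    (h : ToricCongruence Θ Ψ M) (x : Fin m → ℤ) :
    ∃ c : Circle, toricHom z h (NCTorus.mono Θ x) = (c : ℂ) • NCTorus.mono Ψ (M *ᵥ x) :=
  (NCTorus.torusRelations Ψ).exists_map_monomial (NCTorus.U Θ) M z (toricHom z h)
    (toricHom_U z h) x

lemma toricHom_one_mono {m : ℕ} {Θ : Matrix (Fin m) (Fin m) ℝ} (t : Fin m → Circle)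
    (h : ToricCongruence Θ Θ 1) (x : Fin m → ℤ) :
    toricHom t h (NCTorus.mono Θ x) = ((monomial t x : Circle) : ℂ) • NCTorus.mono Θ x := by
  refine map_monomial_of_map_eq_smul (NCTorus.U Θ) (NCTorus.U Θ) (toricHom t h) t (fun j => ?_) x
  have hcol : (fun i => (1 : Matrix (Fin m) (Fin m) ℤ) i j) = Pi.single j 1 :=
    funext fun i => by rw [Matrix.one_apply, Pi.single_apply]
  rw [toricHom_U, hcol, monomial_single]

section RegularRepresentation

variable {m : ℕ} {Θ : Matrix (Fin m) (Fin m) ℝ}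

lemma cocycle_add_left (Θ : Matrix (Fin m) (Fin m) ℝ) (x x' y : Fin m → ℤ) :
    cocycle Θ (x + x') y = cocycle Θ x y * cocycle Θ x' y := by
  simp only [cocycle, cocycleExponent, ← e_add, ← Finset.sum_add_distrib]
  congr 1
  refine Finset.sum_congr rfl fun j _ => Finset.sum_congr rfl fun k _ => ?_
  split_ifs
  · push_cast [Pi.add_apply]; ring
  · simp

variable (S : Type) [NormedAddCommGroup S] [InnerProductSpace ℂ S]

lemma twistedShift_twistedShift_delta (a b x : Fin m → ℤ) (ξ : S) :
    twistedShift Θ S a (twistedShift Θ S b (delta x ξ)) =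
      (cocycle Θ a b : ℂ) • twistedShift Θ S (a + b) (delta x ξ) := by
  simp only [twistedShift_delta, map_smul, smul_smul, cocycle_add_left, cocycle_add_right,
    Circle.coe_mul, add_assoc]
  congr 1
  ring

variable [CompleteSpace S] (Θ)

/-- The twisted shift by `a`, as an element of the unitary group. -/
def shiftUnitary (a : Fin m → ℤ) : unitary (L2 (Fin m → ℤ) S →L[ℂ] L2 (Fin m → ℤ) S) :=
  Unitary.linearIsometryEquiv.symm (twistedShift Θ S a)

/-- Modulo scalars, the twisted shifts form a representation of `ℤᵐ`. -/
def projectiveShift : Multiplicative (Fin m → ℤ) →*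
    ProjectiveUnitary (L2 (Fin m → ℤ) S →L[ℂ] L2 (Fin m → ℤ) S) :=
  MonoidHom.mk' (fun a => toProjective _ (shiftUnitary Θ S a.toAdd)) fun a b => by
    rw [eq_comm, ← map_mul, toProjective_eq_iff]
    exact ⟨cocycle Θ a.toAdd b.toAdd,
      ext_delta fun x ξ => twistedShift_twistedShift_delta S a.toAdd b.toAdd x ξ⟩

variable {Θ} [Nontrivial S] (hΘ : Θᵀ = -Θ)

lemma exists_regularRep_mono (x : Fin m → ℤ) :
    ∃ c : Circle, regularRep hΘ S (NCTorus.mono Θ x) =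
      (c : ℂ) • (shiftUnitary Θ S x : L2 (Fin m → ℤ) S →L[ℂ] L2 (Fin m → ℤ) S) := by
  refine (toProjective_eq_iff
    (a := unitaryMap (regularRep hΘ S) (monomial (NCTorus.U Θ) x))).1 ?_
  rw [map_monomial, map_monomial]
  exact monomial_map_single (projectiveShift Θ S) x

lemma isPhasedPushforward_regularRep (x : Fin m → ℤ) :
    IsPhasedPushforward (x + ·) (regularRep hΘ S (NCTorus.mono Θ x)) := by
  intro y
  obtain ⟨c, hc⟩ := exists_regularRep_mono S hΘ x
  refine ⟨c * cocycle Θ x y, fun ξ => ?_⟩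
  rw [hc, Circle.coe_mul, mul_smul, ← twistedShift_delta]
  rfl

lemma exists_regularRep_mono_delta_zero (x : Fin m → ℤ) :
    ∃ c : Circle, ∀ ξ : S,
      regularRep hΘ S (NCTorus.mono Θ x) (delta 0 ξ) = (c : ℂ) • delta x ξ := by
  simpa only [add_zero] using isPhasedPushforward_regularRep S hΘ x 0

end RegularRepresentation

/-! ### Faithfulness of the regular representation -/

section Averaging

open MeasureTheory
open scoped CStarAlgebra

lemma eq_zero_of_integral_eq_zero {A X : Type*} [CStarAlgebra A] [PartialOrder A]
    [StarOrderedRing A] [TopologicalSpace X] [MeasurableSpace X] [OpensMeasurableSpace X]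
    (μ : Measure X) [μ.IsOpenPosMeasure] [IsFiniteMeasure μ] {f : X → A} (hf : Continuous f)
    (hint : Integrable f μ) (hnonneg : ∀ x, 0 ≤ f x) (hzero : ∫ x, f x ∂μ = 0) (x : X) :
    f x = 0 := by
  suffices h : ∀ ε : ℝ, 0 < ε → ‖f x‖ ≤ ε from
    norm_le_zero_iff.1 (le_of_forall_pos_le_add fun ε hε => by simpa using h ε hε)
  intro ε hε
  let O : Set X := {y | ‖f x - f y‖ < ε}
  have hO : IsOpen O := isOpen_lt (by fun_prop) continuous_const
  have hpos : 0 < μ.real O :=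
    ENNReal.toReal_pos (hO.measure_pos μ ⟨x, by simpa [O] using hε⟩).ne' (measure_ne_top _ _)
  have hlower (y : X) (hy : y ∈ O) : f x - algebraMap ℝ A ε ≤ f y := by
    have hself : IsSelfAdjoint (f x - f y) :=
      (IsSelfAdjoint.of_nonneg (hnonneg x)).sub (IsSelfAdjoint.of_nonneg (hnonneg y))
    have hle : f x - f y ≤ algebraMap ℝ A ε :=
      hself.le_algebraMap_norm_self.trans (algebraMap_mono A (le_of_lt hy))
    exact sub_le_comm.1 hle
  have hintegral : μ.real O • (f x - algebraMap ℝ A ε) ≤ 0 :=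
    calc μ.real O • (f x - algebraMap ℝ A ε)
        = ∫ _ in O, (f x - algebraMap ℝ A ε) ∂μ := (setIntegral_const _).symm
      _ ≤ ∫ y in O, f y ∂μ := setIntegral_mono_on (integrable_const _).integrableOn
          hint.integrableOn hO.measurableSet hlower
      _ ≤ ∫ y, f y ∂μ := by
          rw [← integral_add_compl hO.measurableSet hint]
          exact le_add_of_nonneg_right (integral_nonneg hnonneg)
      _ = 0 := hzero
  have hfx : f x ≤ algebraMap ℝ A ε := by
    refine sub_nonpos.1 ?_
    simpa only [inv_smul_smul₀ hpos.ne', smul_zero] using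
      smul_le_smul_of_nonneg_left hintegral (inv_nonneg.2 hpos.le)
  exact (CStarAlgebra.norm_le_iff_le_algebraMap (f x) hε.le (hnonneg x)).2 hfx

/-- A ⋆-homomorphism between C⋆-algebras as a continuous linear map. -/
def starHomCLM {A B : Type*} [CStarAlgebra A] [CStarAlgebra B] (f : A →⋆ₐ[ℂ] B) : A →L[ℂ] B :=
  ⟨(f : A →ₗ[ℂ] B), map_continuous f⟩

lemma injective_of_integral_eq_zero {A B X : Type*} [CStarAlgebra A] [CStarAlgebra B]
    [TopologicalSpace X] [CompactSpace X] [SecondCountableTopology X] [MeasurableSpace X]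
    [OpensMeasurableSpace X] (μ : Measure X) [μ.IsOpenPosMeasure] [IsFiniteMeasure μ]
    {α : X → A →⋆ₐ[ℂ] A} (hα : ∀ a, Continuous fun t => α t a) {t₀ : X} (ht₀ : ∀ a, α t₀ a = a)
    (ρ : A →⋆ₐ[ℂ] B) (hρ : ∀ a, ρ a = 0 → ∫ t, α t a ∂μ = 0) : Function.Injective ρ := by
  rw [injective_iff_map_eq_zero]
  intro a ha
  let := CStarAlgebra.spectralOrder A
  have := CStarAlgebra.spectralOrderedRing A
  have hzero : α t₀ (star a * a) = 0 :=
    eq_zero_of_integral_eq_zero μ (hα (star a * a))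
      ((hα (star a * a)).integrable_of_hasCompactSupport (HasCompactSupport.of_compactSpace _))
      (fun t => by rw [map_mul, map_star]; exact star_mul_self_nonneg _)
      (hρ _ (by rw [map_mul, ha, mul_zero])) t₀
  rw [ht₀] at hzero
  exact CStarRing.star_mul_self_eq_zero_iff a |>.1 hzero

lemma continuous_of_dense_span {A B X : Type*} [CStarAlgebra A] [CStarAlgebra B]
    [TopologicalSpace X] {s : Set A} (hs : Dense (Submodule.span ℂ s : Set A))
    {α : X → A →⋆ₐ[ℂ] B} (hα : ∀ a ∈ s, Continuous fun t => α t a) (a : A) :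
    Continuous fun t => α t a := by
  have hspan : ∀ a ∈ Submodule.span ℂ s, Continuous fun t => α t a := by
    intro a ha
    induction ha using Submodule.span_induction with
    | zero => simpa only [map_zero] using continuous_const
    | add a a' _ _ h h' => simp only [map_add]; exact h.add h'
    | smul c a _ h => simp only [map_smul]; exact h.const_smul c
    | mem a ha => exact hα a ha
  refine continuous_of_uniform_approx_of_continuous fun u hu => ?_
  obtain ⟨ε, hε, hu⟩ := Metric.mem_uniformity_dist.1 hu
  obtain ⟨c, hc, hac⟩ := Metric.dense_iff.1 hs a ε hε
  refine ⟨_, hspan c hac, fun t => hu ?_⟩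
  rw [dist_eq_norm, ← map_sub]
  refine (NonUnitalStarAlgHom.norm_apply_le (α t) (a - c)).trans_lt ?_
  rwa [← dist_eq_norm, dist_comm]

lemma exists_average {A X : Type*} [CStarAlgebra A] [TopologicalSpace X] [CompactSpace X]
    [SecondCountableTopology X] [MeasurableSpace X] [OpensMeasurableSpace X] (μ : Measure X)
    [IsFiniteMeasure μ] {α : X → A →⋆ₐ[ℂ] A} (hα : ∀ a, Continuous fun t => α t a) :
    ∃ E : A →L[ℂ] A, ∀ a, E a = ∫ t, α t a ∂μ := by
  have hint (a : A) : Integrable (fun t => α t a) μ :=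
    (hα a).integrable_of_hasCompactSupport (HasCompactSupport.of_compactSpace _)
  let E : A →ₗ[ℂ] A :=
    { toFun a := ∫ t, α t a ∂μ
      map_add' a b := by simp only [map_add]; exact integral_add (hint a) (hint b)
      map_smul' c a := by simp only [map_smul]; exact integral_smul c _ }
  refine ⟨E.mkContinuous (μ.real Set.univ) fun a => ?_, fun a => rfl⟩
  rw [mul_comm]
  exact norm_integral_le_of_norm_le_const
    (Filter.Eventually.of_forall fun t => NonUnitalStarAlgHom.norm_apply_le (α t) a)

end Averaging

section Gauge

open MeasureTheory

variable {m : ℕ} (Θ : Matrix (Fin m) (Fin m) ℝ)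

lemma toricCongruence_one : ToricCongruence Θ Θ 1 :=
  ⟨0, by simp, by simp⟩

/-- The gauge action `U_j ↦ t_j U_j` of the torus `𝕋ᵐ` on `A_Θ`. -/
def gauge (t : Fin m → Circle) : NCTorus Θ →⋆ₐ[ℂ] NCTorus Θ :=
  toricHom t (toricCongruence_one Θ)

lemma gauge_mono (t : Fin m → Circle) (x : Fin m → ℤ) :
    gauge Θ t (NCTorus.mono Θ x) = ((monomial t x : Circle) : ℂ) • NCTorus.mono Θ x :=
  toricHom_one_mono t (toricCongruence_one Θ) x

lemma gauge_one (a : NCTorus Θ) : gauge Θ 1 a = a := by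
  have h : starHomCLM (gauge Θ 1) = ContinuousLinearMap.id ℂ (NCTorus Θ) :=
    NCTorus.ext_mono fun x => (gauge_mono Θ 1 x).trans (by simp [monomial_eq_prod])
  exact DFunLike.congr_fun h a

lemma continuous_gauge (a : NCTorus Θ) : Continuous fun t => gauge Θ t a := by
  refine continuous_of_dense_span (NCTorus.dense_span_mono Θ) ?_ a
  rintro _ ⟨x, rfl⟩
  simp only [gauge_mono, monomial_eq_prod]
  fun_prop

lemma exists_monomial_ne_one {x : Fin m → ℤ} (hx : x ≠ 0) :
    ∃ t : Fin m → Circle, monomial t x ≠ 1 := by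
  obtain ⟨j, hj⟩ := Function.ne_iff.1 hx
  have hxj : (x j : ℝ) ≠ 0 := mod_cast hj
  refine ⟨Pi.mulSingle j (Circle.exp (Real.pi / x j)), ?_⟩
  have hpow : Circle.exp (Real.pi / x j) ^ x j = Circle.exp Real.pi := by
    rw [← Circle.exp_zsmul, zsmul_eq_mul, mul_div_cancel₀ _ hxj]
  rw [monomial_eq_prod, Finset.prod_eq_single_of_mem j (Finset.mem_univ j) fun i _ hij => by
    rw [Pi.mulSingle_eq_of_ne hij, one_zpow], Pi.mulSingle_eq_same, hpow, Ne, Circle.ext_iff]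
  norm_num [Circle.coe_exp, Complex.exp_pi_mul_I]

local instance : MeasurableSpace (Fin m → Circle) := borel _

local instance : BorelSpace (Fin m → Circle) := ⟨rfl⟩

lemma integral_monomial {x : Fin m → ℤ} (hx : x ≠ 0) :
    ∫ t : Fin m → Circle, ((monomial t x : Circle) : ℂ) ∂Measure.haar = 0 := by
  obtain ⟨s, hs⟩ := exists_monomial_ne_one hx
  have hinv : ∫ t : Fin m → Circle, ((monomial (s * t) x : Circle) : ℂ) ∂Measure.haar =
      ∫ t : Fin m → Circle, ((monomial t x : Circle) : ℂ) ∂Measure.haar :=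
    integral_mul_left_eq_self (fun t => ((monomial t x : Circle) : ℂ)) s
  have hmul (t : Fin m → Circle) : monomial (s * t) x = monomial s x * monomial t x := by
    simp [monomial_eq_prod, mul_zpow, Finset.prod_mul_distrib]
  simp only [hmul, Circle.coe_mul, integral_const_mul] at hinv
  by_contra h
  exact hs (Circle.ext (by simpa using mul_right_cancel₀ h (hinv.trans (one_mul _).symm)))

variable {Θ} (hΘ : Θᵀ = -Θ) {S : Type} [NormedAddCommGroup S] [InnerProductSpace ℂ S]
  [CompleteSpace S] [Nontrivial S]

lemma smul_integral_gauge (ξ : S) (a : NCTorus Θ) :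
    inner ℂ ξ ξ • ∫ t, gauge Θ t a ∂Measure.haar =
      (((Measure.haar : Measure (Fin m → Circle)).real Set.univ : ℂ) *
        inner ℂ (delta 0 ξ) (regularRep hΘ S a (delta 0 ξ))) • (1 : NCTorus Θ) := by
  obtain ⟨E, hE⟩ := exists_average (Measure.haar : Measure (Fin m → Circle)) (continuous_gauge Θ)
  let τ : NCTorus Θ →L[ℂ] ℂ := innerSL ℂ (delta 0 ξ) ∘L
    ContinuousLinearMap.apply ℂ _ (delta 0 ξ) ∘L starHomCLM (regularRep hΘ S)
  rw [← hE]
  refine DFunLike.congr_fun (f := inner ℂ ξ ξ • E) (g := (((Measure.haar :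
    Measure (Fin m → Circle)).real Set.univ : ℂ) • τ).smulRight (1 : NCTorus Θ))
    (NCTorus.ext_mono fun x => ?_) a
  change inner ℂ ξ ξ • E (NCTorus.mono Θ x) = (_ * inner ℂ (delta 0 ξ)
    (regularRep hΘ S (NCTorus.mono Θ x) (delta 0 ξ))) • (1 : NCTorus Θ)
  simp only [hE, gauge_mono, integral_smul_const]
  obtain rfl | hx := eq_or_ne x 0
  · simp only [monomial_zero, Circle.coe_one, integral_const, NCTorus.mono_zero, map_one,
      one_apply_eq_self, inner_delta_left, delta_apply_self, smul_smul, mul_comm]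
    simp
  · obtain ⟨c, hc⟩ := exists_regularRep_mono_delta_zero S hΘ x
    rw [integral_monomial hx, hc, inner_smul_right, inner_delta_of_ne hx.symm]
    simp only [zero_smul, smul_zero, mul_zero]

lemma regularRep_injective : Function.Injective (regularRep hΘ S) := by
  obtain ⟨ξ, hξ⟩ := exists_ne (0 : S)
  refine injective_of_integral_eq_zero (Measure.haar : Measure (Fin m → Circle))
    (continuous_gauge Θ) (gauge_one Θ) (regularRep hΘ S) fun a ha => ?_
  have h := smul_integral_gauge hΘ ξ a
  rw [ha, zero_apply, inner_zero_right, mul_zero, zero_smul] at h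
  exact (smul_eq_zero.1 h).resolve_left (inner_self_ne_zero.2 hξ)

end Gauge

/-! ### The isometries induced by the connecting maps -/

lemma ToricCongruence.mulVec_injective {m n : ℕ} {Θ : Matrix (Fin m) (Fin m) ℝ}
    {Ψ : Matrix (Fin n) (Fin n) ℝ} {M : Matrix (Fin n) (Fin m) ℤ} (h : ToricCongruence Θ Ψ M)
    (hΘ : Nondegenerate Θ) : Function.Injective M.mulVec := by
  suffices hker : Function.Injective M.mulVecLin from hker
  rw [injective_iff_map_eq_zero]
  intro x hx
  refine hΘ x fun y => ?_
  obtain ⟨K, -, hK⟩ := h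
  have hMx : (fun j => (x j : ℝ)) ᵥ* (M.map (Int.cast : ℤ → ℝ))ᵀ = 0 := by
    rw [Matrix.vecMul_transpose]
    ext i
    have hi := congrArg (Int.cast : ℤ → ℝ) (congrFun hx i)
    simpa [Matrix.mulVec, dotProduct] using hi
  have hpairing : (fun j => (x j : ℝ)) ⬝ᵥ (Θ *ᵥ fun k => (y k : ℝ)) =
      ((x ⬝ᵥ (K *ᵥ y) : ℤ) : ℝ) := by
    rw [sub_eq_iff_eq_add.1 hK, Matrix.add_mulVec, dotProduct_add,
      Matrix.dotProduct_mulVec _ (_ * _ * _), Matrix.mul_assoc, ← Matrix.vecMul_vecMul, hMx]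
    simp [Matrix.mulVec, dotProduct]
  rw [hpairing, e_int]

namespace ToricSystem

variable (T : ToricSystem)

lemma mulVec_injective (n : ℕ) : Function.Injective (T.M n).mulVec :=
  (T.congruence n).mulVec_injective (T.nondegenerate n)

variable (S : Type) [NormedAddCommGroup S] [InnerProductSpace ℂ S] [CompleteSpace S] [Nontrivial S]

lemma exists_Λ_mono (n : ℕ) (x : T.Label n) :
    ∃ p : Circle, ∀ ξ : S, T.Λ n (NCTorus.mono (T.Θ n) x) ξ = (p : ℂ) • delta x ξ :=
  exists_regularRep_mono_delta_zero S (T.skew n) x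

lemma exists_delta_eq_Λ (n : ℕ) (x : T.Label n) :
    ∃ p : Circle, ∀ ξ : S, delta x ξ = (p : ℂ) • T.Λ n (NCTorus.mono (T.Θ n) x) ξ := by
  obtain ⟨p, hp⟩ := T.exists_Λ_mono S n x
  refine ⟨p⁻¹, fun ξ => ?_⟩
  rw [hp, smul_smul, ← Circle.coe_mul, inv_mul_cancel, Circle.coe_one, one_smul]

lemma exists_Λ_φ_mono (n : ℕ) (x : T.Label n) :
    ∃ q : Circle, ∀ ξ : S, T.Λ (n + 1) (T.φ n (NCTorus.mono (T.Θ n) x)) ξ =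
      (q : ℂ) • delta ((T.M n).mulVec x) ξ := by
  obtain ⟨c, hc⟩ := exists_toricHom_mono (T.z n) (T.congruence n) x
  obtain ⟨q, hq⟩ := T.exists_Λ_mono S (n + 1) ((T.M n).mulVec x)
  refine ⟨c * q, fun ξ => ?_⟩
  rw [Circle.coe_mul, mul_smul, ← hq, Λ, Λ, φ, hc, map_smul]
  rfl

variable {S}

/-- The GNS vector `Λ_n(a) ⊗ ξ` as a continuous linear function of `a`. -/
def ΛCLM (n : ℕ) (ξ : S) : T.A n →L[ℂ] T.H S n :=
  ContinuousLinearMap.apply ℂ _ (delta 0 ξ) ∘L starHomCLM (T.π S n)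

lemma π_Λ (n : ℕ) (a b : T.A n) (ξ : S) : T.π S n a (T.Λ n b ξ) = T.Λ n (a * b) ξ := by
  rw [Λ, Λ, map_mul]
  rfl

lemma exists_isGNSIsometry : ∃ I : ∀ n, T.H S n →ₗᵢ[ℂ] T.H S (n + 1), T.IsGNSIsometry I := by
  choose p hp using T.exists_Λ_mono S
  choose q hq using T.exists_Λ_φ_mono S
  choose I hI using fun n =>
    exists_isometry_delta (S := S) (T.mulVec_injective n) fun x => (p n x)⁻¹ * q n x
  refine ⟨I, fun n a ξ => ?_⟩
  have h : (I n).toContinuousLinearMap ∘L T.ΛCLM n ξ =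
      T.ΛCLM (n + 1) ξ ∘L starHomCLM (T.φ n) := by
    refine NCTorus.ext_mono fun x => ?_
    change I n (T.Λ n _ ξ) = T.Λ (n + 1) (T.φ n _) ξ
    rw [hp, hq, map_smul, hI, smul_smul, ← Circle.coe_mul, mul_inv_cancel_left]
  exact DFunLike.congr_fun h a

namespace IsGNSIsometry

variable {T} {I : ∀ n, T.H S n →ₗᵢ[ℂ] T.H S (n + 1)} (hI : T.IsGNSIsometry I)
include hI

lemma isPhasedPushforward (n : ℕ) :
    IsPhasedPushforward (T.M n).mulVec (I n).toContinuousLinearMap := by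
  intro x
  obtain ⟨p, hp⟩ := T.exists_delta_eq_Λ S n x
  obtain ⟨q, hq⟩ := T.exists_Λ_φ_mono S n x
  refine ⟨p * q, fun ξ => ?_⟩
  change I n (delta x ξ) = _
  rw [hp, map_smul, hI, hq, smul_smul, Circle.coe_mul]

lemma eq {I' : ∀ n, T.H S n →ₗᵢ[ℂ] T.H S (n + 1)} (hI' : T.IsGNSIsometry I') : I = I' := by
  ext n : 1
  have h : (I n).toContinuousLinearMap = (I' n).toContinuousLinearMap := by
    refine ext_delta fun x ξ => ?_
    obtain ⟨p, hp⟩ := T.exists_delta_eq_Λ S n x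
    change I n _ = I' n _
    rw [hp, map_smul, map_smul, hI, hI']
  exact LinearIsometry.ext fun η => DFunLike.congr_fun h η

lemma map_π (n : ℕ) (a : T.A n) (η : T.H S n) :
    I n (T.π S n a η) = T.π S (n + 1) (T.φ n a) (I n η) := by
  have h : (I n).toContinuousLinearMap ∘L T.π S n a =
      T.π S (n + 1) (T.φ n a) ∘L (I n).toContinuousLinearMap := by
    refine ext_delta fun x ξ => ?_
    obtain ⟨p, hp⟩ := T.exists_delta_eq_Λ S n x
    change I n (T.π S n a _) = T.π S (n + 1) (T.φ n a) (I n _)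
    simp only [hp, map_smul, π_Λ, hI n, map_mul]
  exact DFunLike.congr_fun h η

end IsGNSIsometry

end ToricSystem

/-! ### The Hilbert space inductive limit -/

section HilbertLimit

variable {H : ℕ → Type} [∀ n, NormedAddCommGroup (H n)] [∀ n, InnerProductSpace ℂ (H n)]

lemma toHilbertLimit_transition (I : ∀ n, H n →ₗᵢ[ℂ] H (n + 1)) {n k : ℕ} (h : n ≤ k) (η : H n) :
    toHilbertLimit I k (isometryTransition I n k h η) = toHilbertLimit I n η :=
  congrArg (fun x : PreHilbertLimit I => (x : HilbertLimit I)) (DirectLimit.mk_apply n k η h)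

variable {I : ∀ n, H n →ₗᵢ[ℂ] H (n + 1)}

lemma mem_of_toHilbertLimit_mem {K : Submodule ℂ (HilbertLimit I)}
    (hK : IsClosed (K : Set (HilbertLimit I))) (n : ℕ)
    (h : ∀ k, n ≤ k → ∀ η, toHilbertLimit I k η ∈ K) (x : HilbertLimit I) : x ∈ K := by
  refine UniformSpace.Completion.induction_on x hK fun y => ?_
  obtain ⟨k, η, rfl⟩ := DirectLimit.exists_eq_mk (isometryTransition I) y
  have hk := h (max n k) (le_max_left n k) (isometryTransition I k _ (le_max_right n k) η)
  rwa [toHilbertLimit_transition] at hk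

lemma ext_toHilbertLimit {E : Type*} [NormedAddCommGroup E] [NormedSpace ℂ E]
    {T T' : HilbertLimit I →L[ℂ] E} (n : ℕ)
    (h : ∀ k, n ≤ k → ∀ η, T (toHilbertLimit I k η) = T' (toHilbertLimit I k η)) : T = T' := by
  ext x : 1
  exact mem_of_toHilbertLimit_mem (K := LinearMap.eqLocus T.toLinearMap T'.toLinearMap)
    (isClosed_eq T.continuous T'.continuous) n h x

end HilbertLimit

/-! ### The label group and the unitary onto `ℓ²(G_∞) ⊗ S` -/

namespace ToricSystem

variable (T : ToricSystem)

lemma labelTransition_injective (n k : ℕ) (h : n ≤ k) :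
    Function.Injective (T.labelTransition n k h) := by
  induction k, h using Nat.le_induction with
  | base => intro x y hxy; simpa [labelTransition] using hxy
  | succ k h ih =>
    rw [T.labelTransition_succ n k h]
    exact (T.mulVec_injective k).comp ih

lemma label_injective (n : ℕ) : Function.Injective (T.label n) :=
  DirectLimit.mk_injective T.labelTransition T.labelTransition_injective n

lemma label_transition {n k : ℕ} (h : n ≤ k) (x : T.Label n) :
    T.label k (T.labelTransition n k h x) = T.label n x :=
  DirectLimit.mk_apply n k x h

lemma exists_label (g : T.G) : ∃ n x, T.label n x = g := by
  obtain ⟨n, x, h⟩ := DirectLimit.exists_eq_mk T.labelTransition g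
  exact ⟨n, x, h.symm⟩

lemma label_add (n : ℕ) (x y : T.Label n) : T.label n (x + y) = T.label n x + T.label n y :=
  (DirectLimit.add_def n x y).symm

lemma exists_limit_function {C : Type*} (F : ∀ n, T.Label n → C)
    (hF : ∀ n (x : T.Label n), F (n + 1) ((T.M n).mulVec x) = F n x) :
    ∃ Finf : T.G → C, ∀ n x, Finf (T.label n x) = F n x := by
  refine ⟨DirectLimit.lift T.labelTransition F fun n k h x => ?_, fun n x => rfl⟩
  induction k, h using Nat.le_induction with
  | base => simp [labelTransition]
  | succ k h ih =>
    rw [T.labelTransition_succ n k h, ih]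
    exact (hF k _).symm

namespace IsGNSIsometry

variable {T} {S : Type} [NormedAddCommGroup S] [InnerProductSpace ℂ S] [CompleteSpace S]
  [Nontrivial S] {I : ∀ n, T.H S n →ₗᵢ[ℂ] T.H S (n + 1)} (hI : T.IsGNSIsometry I)
include hI

lemma isPhasedPushforward_transition {n k : ℕ} (h : n ≤ k) :
    IsPhasedPushforward (T.labelTransition n k h)
      (isometryTransition I n k h).toContinuousLinearMap := by
  induction k, h using Nat.le_induction with
  | base => exact fun x => ⟨1, fun ξ => by simp [labelTransition, isometryTransition]⟩
  | succ k h ih =>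
    rw [T.labelTransition_succ n k h, isometryTransition_succ I n k h]
    exact (hI.isPhasedPushforward k).comp ih

lemma exists_toHilbertLimit_delta {n k : ℕ} (h : n ≤ k) (x : T.Label n) :
    ∃ c : Circle, ∀ ξ : S, toHilbertLimit I n (delta x ξ) =
      (c : ℂ) • toHilbertLimit I k (delta (T.labelTransition n k h x) ξ) := by
  obtain ⟨c, hc⟩ := hI.isPhasedPushforward_transition h x
  refine ⟨c, fun ξ => ?_⟩
  rw [← toHilbertLimit_transition I h, ← map_smul, ← hc]
  rfl

lemma exists_phase_of_label_eq {n n' : ℕ} {x : T.Label n} {x' : T.Label n'}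
    (h : T.label n x = T.label n' x') :
    ∃ c : Circle, ∀ ξ : S,
      toHilbertLimit I n (delta x ξ) = (c : ℂ) • toHilbertLimit I n' (delta x' ξ) := by
  obtain ⟨k, hn, hn'⟩ := exists_ge_ge n n'
  obtain ⟨c, hc⟩ := hI.exists_toHilbertLimit_delta hn x
  obtain ⟨c', hc'⟩ := hI.exists_toHilbertLimit_delta hn' x'
  have hk : T.labelTransition n k hn x = T.labelTransition n' k hn' x' :=
    T.label_injective k (by rw [T.label_transition, T.label_transition, h])
  refine ⟨c * c'⁻¹, fun ξ => ?_⟩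
  rw [hc, hc', hk, smul_smul, ← Circle.coe_mul, inv_mul_cancel_right]

lemma inner_eq_zero_of_label_ne {n n' : ℕ} {x : T.Label n} {x' : T.Label n'}
    (h : T.label n x ≠ T.label n' x') (ξ ξ' : S) :
    inner ℂ (toHilbertLimit I n (delta x ξ)) (toHilbertLimit I n' (delta x' ξ')) = 0 := by
  obtain ⟨k, hn, hn'⟩ := exists_ge_ge n n'
  obtain ⟨c, hc⟩ := hI.exists_toHilbertLimit_delta hn x
  obtain ⟨c', hc'⟩ := hI.exists_toHilbertLimit_delta hn' x'
  have hk : T.labelTransition n k hn x ≠ T.labelTransition n' k hn' x' := fun hk =>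
    h (by rw [← T.label_transition hn, hk, T.label_transition])
  rw [hc, hc', inner_smul_left, inner_smul_right, LinearIsometry.inner_map_map,
    inner_delta_of_ne hk, mul_zero, mul_zero]

lemma isHilbertSum_representatives {r : T.G → ℕ} {y : ∀ g, T.Label (r g)}
    (hy : ∀ g, T.label (r g) (y g) = g) :
    IsHilbertSum ℂ (fun _ : T.G => S) fun g =>
      (toHilbertLimit I (r g)).comp (deltaIsometry S (y g)) := by
  refine .mk (fun g g' hg ξ ξ' => hI.inner_eq_zero_of_label_ne (by rwa [hy, hy]) ξ ξ')
    fun z _ => ?_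
  set K := (⨆ g, LinearMap.range ((toHilbertLimit I (r g)).comp
    (deltaIsometry S (y g))).toLinearMap).topologicalClosure
  have hK : IsClosed (K : Set (HilbertLimit I)) := Submodule.isClosed_topologicalClosure _
  refine mem_of_toHilbertLimit_mem hK 0 (fun n _ η => ?_) z
  refine mem_of_forall_delta_mem (K := K.comap (toHilbertLimit I n).toLinearMap)
    (hK.preimage (toHilbertLimit I n).continuous) (fun x ξ => ?_) η
  obtain ⟨c, hc⟩ := hI.exists_phase_of_label_eq (hy (T.label n x)).symm
  change toHilbertLimit I n (delta x ξ) ∈ K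
  rw [hc]
  exact K.smul_mem _ (Submodule.le_topologicalClosure _
    (Submodule.mem_iSup_of_mem (T.label n x) ⟨ξ, rfl⟩))

theorem exists_unitary :
    ∃ (V : HilbertLimit I ≃ₗᵢ[ℂ] L2 T.G S) (χ : ∀ n, T.Label n → Circle),
      ∀ n (x : T.Label n) (ξ : S),
        V (toHilbertLimit I n (delta x ξ)) = (χ n x : ℂ) • delta (T.label n x) ξ := by
  classical
  choose r y hy using T.exists_label
  choose χ hχ using fun n (x : T.Label n) =>
    hI.exists_phase_of_label_eq (hy (T.label n x)).symm
  have hsum := hI.isHilbertSum_representatives hy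
  have hsymm (g : T.G) (ξ : S) : hsum.linearIsometryEquiv.symm (delta g ξ) =
      toHilbertLimit I (r g) (delta (y g) ξ) := by
    refine Eq.trans ?_ (hsum.linearIsometryEquiv_symm_apply_single ξ)
    unfold delta
    congr!
  refine ⟨hsum.linearIsometryEquiv, χ, fun n x ξ => ?_⟩
  rw [hχ, map_smul, ← hsymm, LinearIsometryEquiv.apply_symm_apply]

end IsGNSIsometry

end ToricSystem

/-! ### Diagonal operators -/

section Multiplier

variable {G G' S : Type} [NormedAddCommGroup S] [InnerProductSpace ℂ S] [CompleteSpace S]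

lemma mem_graph_multiplier {F : G → selfAdjoint (S →L[ℂ] S)} {f h : L2 G S} :
    (f, h) ∈ (multiplier F).graph ↔ ∀ g, h g = (F g : S →L[ℂ] S) (f g) := by
  rw [LinearPMap.mem_graph_iff]
  constructor
  · rintro ⟨f', rfl, rfl⟩ g
    rfl
  · intro hfh
    have hf : Memℓp (fun g => (F g : S →L[ℂ] S) (f g)) 2 := by
      simpa only [← hfh] using lp.memℓp h
    exact ⟨⟨f, hf⟩, rfl, lp.ext (funext fun g => (hfh g).symm)⟩

lemma IsPhasedPushforward.map_mem_graph_multiplier {f : G → G'} {W : L2 G S →L[ℂ] L2 G' S}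
    (hW : IsPhasedPushforward f W) (hf : Function.Injective f) {F : G' → selfAdjoint (S →L[ℂ] S)}
    {η ζ : L2 G S} (h : (η, ζ) ∈ (multiplier (F ∘ f)).graph) :
    (W η, W ζ) ∈ (multiplier F).graph := by
  rw [mem_graph_multiplier] at h ⊢
  intro y
  by_cases hy : y ∈ Set.range f
  · obtain ⟨x, rfl⟩ := hy
    obtain ⟨c, hc⟩ := hW.exists_phase_apply hf x
    rw [hc, hc, h, map_smul, Function.comp_apply]
  · rw [hW.apply_of_notMem_range hy, hW.apply_of_notMem_range hy, map_zero]

variable (F : G → selfAdjoint (S →L[ℂ] S))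

lemma isClosed_graph_multiplier : IsClosed ((multiplier F).graph : Set (L2 G S × L2 G S)) := by
  have h : ((multiplier F).graph : Set (L2 G S × L2 G S)) =
      ⋂ g, {p | lp.evalCLM ℂ (fun _ : G => S) 2 g p.2 =
        (F g : S →L[ℂ] S) (lp.evalCLM ℂ (fun _ : G => S) 2 g p.1)} := by
    ext ⟨f, h⟩
    simp only [SetLike.mem_coe, mem_graph_multiplier, Set.mem_iInter]
    rfl
  rw [h]
  exact isClosed_iInter fun g => isClosed_eq (by fun_prop) (by fun_prop)

lemma delta_mem_graph_multiplier (g : G) (ξ : S) :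
    (delta g ξ, delta g ((F g : S →L[ℂ] S) ξ)) ∈ (multiplier F).graph := by
  rw [mem_graph_multiplier]
  intro h
  obtain rfl | hgh := eq_or_ne h g
  · rw [delta_apply_self, delta_apply_self]
  · rw [delta_apply_ne _ hgh, delta_apply_ne _ hgh, map_zero]

lemma graph_multiplier_le {K : Submodule ℂ (L2 G S × L2 G S)}
    (hK : IsClosed (K : Set (L2 G S × L2 G S)))
    (h : ∀ g ξ, (delta g ξ, delta g ((F g : S →L[ℂ] S) ξ)) ∈ K) : (multiplier F).graph ≤ K := by
  rintro ⟨f, f'⟩ hf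
  rw [mem_graph_multiplier] at hf
  refine hK.mem_of_tendsto ((hasSum_delta f).prodMk (hasSum_delta f'))
    (Filter.Eventually.of_forall fun _ => K.sum_mem fun g _ => ?_)
  rw [hf]
  exact h g (f g)

lemma dense_domain_multiplier : Dense ((multiplier F).domain : Set (L2 G S)) := by
  rw [Submodule.dense_iff_topologicalClosure_eq_top, eq_top_iff]
  exact fun f _ => mem_of_forall_delta_mem (Submodule.isClosed_topologicalClosure _)
    (fun g ξ => Submodule.le_topologicalClosure _
      (LinearPMap.mem_domain_of_mem_graph (delta_mem_graph_multiplier F g ξ))) f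

end Multiplier

/-! ### Self-adjointness and resolvents in terms of graphs -/

section Graph

variable {H : Type*} [NormedAddCommGroup H] [InnerProductSpace ℂ H] {D : H →ₗ.[ℂ] H}

lemma isSelfAdjoint_iff_forall_mem_graph_iff [CompleteSpace H] (hD : Dense (D.domain : Set H)) :
    IsSelfAdjoint D ↔ ∀ y w, (y, w) ∈ D.graph ↔
      ∀ η ζ, (η, ζ) ∈ D.graph → inner ℂ ζ y = inner ℂ η w := by
  have hadj : ∀ y w, (y, w) ∈ D.adjoint.graph ↔
      ∀ η ζ, (η, ζ) ∈ D.graph → inner ℂ ζ y = inner ℂ η w := by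
    intro y w
    rw [LinearPMap.adjoint_graph_eq_graph_adjoint hD, Submodule.mem_adjoint_iff]
    simp only [sub_eq_zero]
  rw [LinearPMap.isSelfAdjoint_def]
  simp only [← hadj]
  constructor
  · intro h y w
    rw [h]
  · intro h
    exact (LinearPMap.eq_of_eq_graph (Submodule.ext fun p => h p.1 p.2)).symm

lemma isResolvent_iff_graph {z : ℂ} {R : H →L[ℂ] H} :
    IsResolvent D z R ↔ (∀ η ζ, (η, ζ) ∈ D.graph → R (ζ - z • η) = η) ∧
      ∀ η, (R η, η + z • R η) ∈ D.graph := by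
  refine and_congr ⟨fun h η ζ hηζ => ?_, fun h ξ => h _ _ (D.mem_graph ξ)⟩
    (forall_congr' fun η => ⟨?_, fun h => ?_⟩)
  · obtain ⟨ξ, rfl, rfl⟩ := D.mem_graph_iff.1 hηζ
    exact h ξ
  · rintro ⟨ξ, hξ, hDξ⟩
    exact D.mem_graph_iff.2 ⟨ξ, hξ, by rw [← hξ, ← sub_eq_iff_eq_add, hDξ]⟩
  · obtain ⟨ξ, hξ, hDξ⟩ := D.mem_graph_iff.1 h
    exact ⟨ξ, hξ, by rw [hDξ, hξ, add_sub_cancel_right]⟩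

/-- `W` preserves the domain of `D`, and `[D, W]` extends to a bounded operator. -/
def HasBoundedCommutator (D : H →ₗ.[ℂ] H) (W : H →L[ℂ] H) : Prop :=
  ∃ C : H →L[ℂ] H, ∀ η ζ, (η, ζ) ∈ D.graph → (W η, W ζ + C η) ∈ D.graph

variable {A : Type*} [CStarAlgebra A] [CompleteSpace H]

/-- The elements of `A` that preserve the domain of `D` and have bounded commutator with `D`. Unlike
`boundedCommutators`, where `[D, π(a)]` is only densely defined, they form a subspace. -/
def smoothElements (π : A →⋆ₐ[ℂ] (H →L[ℂ] H)) (D : H →ₗ.[ℂ] H) : Submodule ℂ A where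
  carrier := {a | HasBoundedCommutator D (π a)}
  zero_mem' := ⟨0, fun η ζ _ => by
    simp only [map_zero, zero_apply, add_zero]
    exact D.graph.zero_mem⟩
  add_mem' := by
    rintro a b ⟨C, hC⟩ ⟨C', hC'⟩
    refine ⟨C + C', fun η ζ h => ?_⟩
    rw [map_add, add_apply, add_apply, add_apply, add_add_add_comm]
    exact D.graph.add_mem (hC η ζ h) (hC' η ζ h)
  smul_mem' := by
    rintro c a ⟨C, hC⟩
    refine ⟨c • C, fun η ζ h => ?_⟩
    rw [map_smul, smul_apply, smul_apply, smul_apply, ← smul_add]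
    exact D.graph.smul_mem c (hC η ζ h)

lemma smoothElements_subset_boundedCommutators (π : A →⋆ₐ[ℂ] (H →L[ℂ] H))
    (hD : Dense (D.domain : Set H)) :
    (smoothElements π D : Set A) ⊆ boundedCommutators π D := by
  rintro a ⟨C, hC⟩
  refine ⟨hD.mono fun η hη => ⟨hη, LinearPMap.mem_domain_of_mem_graph
    (hC _ _ (D.mem_graph ⟨η, hη⟩))⟩, C, fun η hη hη' => ?_⟩
  have h := (D.mem_graph ⟨π a η, hη'⟩)
  rw [eq_sub_iff_add_eq', D.mem_graph_snd_inj (hC _ _ (D.mem_graph ⟨η, hη⟩)) h rfl]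

end Graph

/-! ### Unitary equivalence of unbounded operators -/

section UnitarilyEquivalent

variable {H K : Type*} [NormedAddCommGroup H] [InnerProductSpace ℂ H] [NormedAddCommGroup K]
  [InnerProductSpace ℂ K]

/-- The unitary `V` carries `D` to `D'`: `V D V⁻¹ = D'`, equality of domains included. -/
def UnitarilyEquivalent (V : H ≃ₗᵢ[ℂ] K) (D : H →ₗ.[ℂ] H) (D' : K →ₗ.[ℂ] K) : Prop :=
  ∀ η ζ, (η, ζ) ∈ D.graph ↔ (V η, V ζ) ∈ D'.graph

namespace UnitarilyEquivalent

variable {V : H ≃ₗᵢ[ℂ] K} {D : H →ₗ.[ℂ] H} {D' : K →ₗ.[ℂ] K}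

lemma symm (h : UnitarilyEquivalent V D D') : UnitarilyEquivalent V.symm D' D := fun η ζ => by
  rw [h, V.apply_symm_apply, V.apply_symm_apply]

lemma dense_domain (h : UnitarilyEquivalent V D D') (hD' : Dense (D'.domain : Set K)) :
    Dense (D.domain : Set H) := by
  refine (hD'.preimage V.toHomeomorph.isOpenMap).mono fun η hη => ?_
  have hη' := (h.symm _ _).1 (D'.mem_graph ⟨V η, hη⟩)
  rw [V.symm_apply_apply] at hη'
  exact LinearPMap.mem_domain_of_mem_graph hη'

lemma isSelfAdjoint [CompleteSpace H] [CompleteSpace K] (h : UnitarilyEquivalent V D D')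
    (hD' : IsSelfAdjoint D') : IsSelfAdjoint D := by
  rw [isSelfAdjoint_iff_forall_mem_graph_iff (h.dense_domain hD'.dense_domain)]
  intro y w
  rw [h, (isSelfAdjoint_iff_forall_mem_graph_iff hD'.dense_domain).1 hD']
  refine V.surjective.forall.trans (forall_congr' fun η => V.surjective.forall.trans
    (forall_congr' fun ζ => ?_))
  rw [← h, V.inner_map_map, V.inner_map_map]

lemma isResolvent (h : UnitarilyEquivalent V D D') {z : ℂ} {R : K →L[ℂ] K}
    (hR : IsResolvent D' z R) :
    IsResolvent D z (V.symm.toContinuousLinearEquiv.conjContinuousAlgEquiv R) := by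
  rw [isResolvent_iff_graph] at hR ⊢
  refine ⟨fun η ζ hηζ => ?_, fun η => ?_⟩
  · change V.symm (R (V (ζ - z • η))) = η
    rw [map_sub, map_smul, hR.1 _ _ ((h _ _).1 hηζ), V.symm_apply_apply]
  · change (V.symm (R (V η)), η + z • V.symm (R (V η))) ∈ D.graph
    rw [h, map_add, map_smul, V.apply_symm_apply]
    exact hR.2 (V η)

lemma hasCompactResolvent (h : UnitarilyEquivalent V D D') (hD' : HasCompactResolvent D') :
    HasCompactResolvent D := by
  obtain ⟨⟨z, R, hR⟩, hcompact⟩ := hD'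
  refine ⟨⟨z, _, h.isResolvent hR⟩, fun z R hR => ?_⟩
  have hVR := hcompact z _ (h.symm.isResolvent hR)
  have hconj : (V.symm : K →L[ℂ] H) ∘L V.symm.symm.toContinuousLinearEquiv.conjContinuousAlgEquiv R
      ∘L (V : H →L[ℂ] K) = R := by
    ext η
    simp
  exact hconj ▸ (hVR.comp_clm (V : H →L[ℂ] K)).clm_comp (V.symm : K →L[ℂ] H)

lemma hasBoundedCommutator (h : UnitarilyEquivalent V D D') {W : H →L[ℂ] H}
    (hW : HasBoundedCommutator D' (V.toContinuousLinearEquiv.conjContinuousAlgEquiv W)) :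
    HasBoundedCommutator D W := by
  obtain ⟨C, hC⟩ := hW
  refine ⟨V.symm.toContinuousLinearEquiv.conjContinuousAlgEquiv C, fun η ζ hηζ => ?_⟩
  have hV := hC _ _ ((h η ζ).1 hηζ)
  change (V (W (V.symm (V η))), V (W (V.symm (V ζ))) + C (V η)) ∈ D'.graph at hV
  change (W η, W ζ + V.symm (C (V η))) ∈ D.graph
  rwa [h, map_add, V.apply_symm_apply, ← V.symm_apply_apply η, ← V.symm_apply_apply ζ,
    V.apply_symm_apply]

end UnitarilyEquivalent

end UnitarilyEquivalent

/-! ### Diagonal operators with compact resolvent -/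

section Resolvent

variable {A : Type*} [CStarAlgebra A] {a : A}

lemma norm_resolvent_le [IsStarNormal a] {z : ℂ} {r : ℝ} (hr : 0 < r)
    (h : ∀ t ∈ spectrum ℂ a, r ≤ ‖z - t‖) :
    z ∈ resolventSet ℂ a ∧ ‖resolvent a z‖ ≤ r⁻¹ := by
  have hz : z ∈ resolventSet ℂ a := spectrum.notMem_iff.1 fun hz => by
    simpa using hr.trans_le (h z hz)
  obtain ⟨u, hu⟩ := id hz
  have hnormal : IsStarNormal (u : A) := ⟨by
    rw [hu, star_sub]
    refine Commute.sub_left ?_ (Commute.sub_right ?_ (star_comm_self' a))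
    · rw [← algebraMap_star_comm]
      exact Algebra.commute_algebraMap_left _ _
    · exact Algebra.commute_algebraMap_right _ _⟩
  refine ⟨hz, ?_⟩
  have hradius : spectralRadius ℂ (↑u⁻¹ : A) ≤ (r⁻¹).toNNReal := by
    refine iSup₂_le fun k hk => ?_
    rw [← spectrum.map_inv, Set.mem_inv, hu, ← spectrum.singleton_sub_eq] at hk
    obtain ⟨_, rfl, t, ht, htk⟩ := hk
    have hrk : r ≤ ‖k‖⁻¹ := by
      rw [← norm_inv, ← htk]
      exact h t ht
    rw [← enorm_eq_nnnorm, ← ofReal_norm]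
    exact ENNReal.ofReal_le_ofReal ((le_inv_comm₀ hr (inv_pos.1 (hr.trans_le hrk))).1 hrk)
  rw [IsStarNormal.spectralRadius_eq_nnnorm, ENNReal.coe_le_coe, ← NNReal.coe_le_coe,
    coe_nnnorm, Real.coe_toNNReal _ (inv_nonneg.2 hr.le)] at hradius
  rwa [resolvent, ← hu, Ring.inverse_unit]

end Resolvent

section Truncation

variable {G S : Type} [NormedAddCommGroup S] [InnerProductSpace ℂ S]

lemma norm_le_mul_norm_of_forall_apply {f h : L2 G S} {c : ℝ} (hc : 0 ≤ c)
    (hfh : ∀ g, ‖f g‖ ≤ c * ‖h g‖) : ‖f‖ ≤ c * ‖h‖ := by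
  have hch : ‖f‖ ≤ ‖(c : ℂ) • h‖ := lp.norm_mono (by norm_num) fun g => by
    rw [lp.coeFn_smul, Pi.smul_apply, norm_smul, Complex.norm_real, Real.norm_of_nonneg hc]
    exact hfh g
  rwa [norm_smul, Complex.norm_real, Real.norm_of_nonneg hc] at hch

/-- The restriction of vectors in `ℓ²(G) ⊗ S` to a finite set of labels. -/
def truncation (E : Finset G) : L2 G S →L[ℂ] L2 G S :=
  ∑ g ∈ E, (deltaIsometry S g).toContinuousLinearMap ∘L lp.evalCLM ℂ (fun _ : G => S) 2 g

open Classical in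
lemma truncation_apply (E : Finset G) (f : L2 G S) (g : G) :
    truncation E f g = if g ∈ E then f g else 0 := by
  have hsum : truncation E f = ∑ h ∈ E, (delta h (f h) : L2 G S) := by
    rw [truncation, sum_apply]
    rfl
  rw [hsum, lp.coeFn_sum, Finset.sum_apply]
  split_ifs with hg
  · rw [Finset.sum_eq_single_of_mem g hg fun h _ hhg => delta_apply_ne _ hhg.symm,
      delta_apply_self]
  · exact Finset.sum_eq_zero fun h hh => delta_apply_ne _ fun hgh => hg (hgh ▸ hh)

lemma isCompactOperator_truncation [FiniteDimensional ℂ S] (E : Finset G) :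
    IsCompactOperator (truncation E : L2 G S →L[ℂ] L2 G S) := by
  have : ProperSpace S := FiniteDimensional.proper ℂ S
  refine Submodule.sum_mem (compactOperator (RingHom.id ℂ) (L2 G S) (L2 G S)) fun g _ => ?_
  exact (isCompactOperator_id.comp_clm (lp.evalCLM ℂ (fun _ : G => S) 2 g)).clm_comp
    (deltaIsometry S g).toContinuousLinearMap

lemma isCompactOperator_of_forall_exists_finset [CompleteSpace S] [FiniteDimensional ℂ S]
    {T : L2 G S →L[ℂ] L2 G S}
    (h : ∀ ε > 0, ∃ E : Finset G, ∀ f, ∀ g ∉ E, ‖T f g‖ ≤ ε * ‖f g‖) : IsCompactOperator T := by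
  refine isClosed_setOfPred_isCompactOperator.closure_subset
    (Metric.mem_closure_iff.2 fun ε hε => ?_)
  obtain ⟨E, hE⟩ := h (ε / 2) (half_pos hε)
  refine ⟨truncation E ∘L T, (isCompactOperator_truncation E).comp_clm T, ?_⟩
  rw [dist_eq_norm]
  refine (ContinuousLinearMap.opNorm_le_bound _ (half_pos hε).le fun f => ?_).trans_lt
    (half_lt_self hε)
  refine norm_le_mul_norm_of_forall_apply (half_pos hε).le fun g => ?_
  rw [sub_apply, lp.coeFn_sub, Pi.sub_apply, ContinuousLinearMap.comp_apply, truncation_apply]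
  split_ifs with hg
  · rw [sub_self, norm_zero]
    positivity
  · rw [sub_zero]
    exact hE f g hg

end Truncation

section FiniteSpectralMultiplicity

lemma finite_of_finiteDimensional_directSum {ι S : Type*} [AddCommGroup S] [Module ℂ S]
    [Nontrivial S] [FiniteDimensional ℂ (DirectSum ι fun _ => S)] : Finite ι := by
  classical
  obtain ⟨ξ, hξ⟩ := exists_ne (0 : S)
  have hindep : LinearIndependent ℂ fun i : ι => DirectSum.lof ℂ ι (fun _ => S) i ξ := by
    refine linearIndependent_iff'.2 fun s c hc i hi => (smul_eq_zero.1 ?_).resolve_right hξ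
    have hci := congrArg (DirectSum.component ℂ ι (fun _ => S) i) hc
    rw [map_sum, map_zero, Finset.sum_eq_single_of_mem i hi fun j _ hj => by
      rw [map_smul, DirectSum.component.of, dif_neg hj, smul_zero]] at hci
    rwa [map_smul, DirectSum.component.lof_self] at hci
  exact hindep.finite

variable {G S : Type} [NormedAddCommGroup S] [InnerProductSpace ℂ S] [CompleteSpace S]
  [Nontrivial S] {F : G → selfAdjoint (S →L[ℂ] S)}

namespace FiniteSpectralMultiplicity

lemma finiteDimensional [Nonempty G] (hF : FiniteSpectralMultiplicity F) :
    FiniteDimensional ℂ S := by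
  classical
  obtain ⟨g⟩ := ‹Nonempty G›
  obtain ⟨t, ht⟩ := spectrum.nonempty (F g : S →L[ℂ] S)
  rw [(F g).2.mem_spectrum_eq_re ht] at ht
  have := hF (|t.re| + 1) (by positivity)
  let i : {g : G // ∃ s ∈ Set.Icc (-(|t.re| + 1)) (|t.re| + 1),
      (s : ℂ) ∈ spectrum ℂ (F g : S →L[ℂ] S)} :=
    ⟨g, t.re, abs_le.1 (lt_add_one |t.re|).le, ht⟩
  exact FiniteDimensional.of_injective (DirectSum.lof ℂ _ (fun _ => S) i)
    (DirectSum.of_injective i)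

lemma finite_setOf_spectrum_norm_lt (hF : FiniteSpectralMultiplicity F) {r : ℝ} (hr : 0 < r) :
    {g | ∃ t ∈ spectrum ℂ (F g : S →L[ℂ] S), ‖t‖ < r}.Finite := by
  have := hF r hr
  have hfinite : Finite {g : G // ∃ t ∈ Set.Icc (-r) r, (t : ℂ) ∈ spectrum ℂ (F g : S →L[ℂ] S)} :=
    finite_of_finiteDimensional_directSum (S := S)
  refine (Set.finite_coe_iff.1 hfinite).subset ?_
  rintro g ⟨t, ht, htr⟩
  rw [(F g).2.mem_spectrum_eq_re ht] at ht
  exact ⟨t.re, abs_le.1 ((Complex.abs_re_le_norm t).trans htr.le), ht⟩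

end FiniteSpectralMultiplicity

end FiniteSpectralMultiplicity

section Multiplier

variable {G S : Type} [NormedAddCommGroup S] [InnerProductSpace ℂ S] [CompleteSpace S]
  {F : G → selfAdjoint (S →L[ℂ] S)}

lemma isSelfAdjoint_multiplier (F : G → selfAdjoint (S →L[ℂ] S)) :
    IsSelfAdjoint (multiplier F) := by
  rw [isSelfAdjoint_iff_forall_mem_graph_iff (dense_domain_multiplier F)]
  have hsymm (g : G) (ξ η : S) :
      inner ℂ ((F g : S →L[ℂ] S) ξ) η = inner ℂ ξ ((F g : S →L[ℂ] S) η) :=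
    (F g).2.isSymmetric ξ η
  refine fun y w => ⟨fun hyw η ζ hηζ => ?_, fun h => ?_⟩
  · rw [mem_graph_multiplier] at hyw hηζ
    rw [lp.inner_eq_tsum, lp.inner_eq_tsum]
    exact tsum_congr fun g => by rw [hyw, hηζ, hsymm]
  · rw [mem_graph_multiplier]
    refine fun g => ext_inner_left ℂ fun ξ => ?_
    rw [← inner_delta_left, ← h _ _ (delta_mem_graph_multiplier F g ξ), inner_delta_left, hsymm]

lemma exists_isResolvent_multiplier (F : G → selfAdjoint (S →L[ℂ] S)) :
    ∃ R, IsResolvent (multiplier F) Complex.I R := by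
  have hres (g : G) : Complex.I ∈ resolventSet ℂ (F g : S →L[ℂ] S) ∧
      ‖resolvent (F g : S →L[ℂ] S) Complex.I‖ ≤ 1⁻¹ := by
    have : IsStarNormal (F g : S →L[ℂ] S) := (F g).2.isStarNormal
    refine norm_resolvent_le one_pos fun t ht => ?_
    have him : (Complex.I - t).im = 1 := by
      rw [(F g).2.mem_spectrum_eq_re ht]
      simp
    exact (him.ge.trans (le_abs_self _)).trans (Complex.abs_im_le_norm _)
  let R : L2 G S →L[ℂ] L2 G S := -lp.mapCLM 2
    (fun g => resolvent (F g : S →L[ℂ] S) Complex.I) (by norm_num) fun g => (hres g).2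
  have hR (η : L2 G S) (g : G) : R η g = -resolvent (F g : S →L[ℂ] S) Complex.I (η g) := rfl
  refine ⟨R, isResolvent_iff_graph.2 ⟨fun η ζ hηζ => ?_, fun η => ?_⟩⟩
  · rw [mem_graph_multiplier] at hηζ
    ext g
    rw [hR, lp.coeFn_sub, Pi.sub_apply, hηζ, lp.coeFn_smul, Pi.smul_apply, ← map_neg, neg_sub]
    exact DFunLike.congr_fun (Ring.inverse_mul_cancel _ (hres g).1) (η g)
  · refine mem_graph_multiplier.2 fun g => ?_
    have hinv : Complex.I • resolvent (F g : S →L[ℂ] S) Complex.I (η g) -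
        (F g : S →L[ℂ] S) (resolvent (F g : S →L[ℂ] S) Complex.I (η g)) = η g :=
      DFunLike.congr_fun (Ring.mul_inverse_cancel _ (hres g).1) (η g)
    rw [lp.coeFn_add, Pi.add_apply, lp.coeFn_smul, Pi.smul_apply, hR, map_neg, smul_neg,
      ← sub_eq_add_neg, sub_eq_iff_eq_add, neg_add_eq_sub, hinv]

lemma isCompactOperator_of_isResolvent_multiplier [FiniteDimensional ℂ S] [Nontrivial S]
    (hF : FiniteSpectralMultiplicity F) {z : ℂ} {R : L2 G S →L[ℂ] L2 G S}
    (hR : IsResolvent (multiplier F) z R) : IsCompactOperator R := by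
  refine isCompactOperator_of_forall_exists_finset fun ε hε => ?_
  have hfin := hF.finite_setOf_spectrum_norm_lt (r := ‖z‖ + ε⁻¹) (by positivity)
  refine ⟨hfin.toFinset, fun η g hg => ?_⟩
  simp only [Set.Finite.mem_toFinset, Set.mem_ofPred_eq, not_exists, not_and, not_lt] at hg
  have : IsStarNormal (F g : S →L[ℂ] S) := (F g).2.isStarNormal
  obtain ⟨hz, hnorm⟩ := norm_resolvent_le (z := z) (inv_pos.2 hε) fun t ht => by
    linarith [hg t ht, norm_sub_norm_le t z, norm_sub_rev t z]
  have hη : η g = (F g : S →L[ℂ] S) (R η g) - z • R η g :=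
    eq_sub_of_add_eq (mem_graph_multiplier.1 ((isResolvent_iff_graph.1 hR).2 η) g)
  have hRη : R η g = -resolvent (F g : S →L[ℂ] S) z (η g) := by
    rw [hη, ← map_neg, neg_sub]
    exact (DFunLike.congr_fun (Ring.inverse_mul_cancel _ hz) (R η g)).symm
  rw [inv_inv] at hnorm
  rw [hRη, norm_neg]
  exact (resolvent (F g : S →L[ℂ] S) z).le_of_opNorm_le hnorm (η g)

lemma hasCompactResolvent_multiplier [FiniteDimensional ℂ S] [Nontrivial S]
    (hF : FiniteSpectralMultiplicity F) : HasCompactResolvent (multiplier F) :=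
  ⟨⟨Complex.I, exists_isResolvent_multiplier F⟩, fun _ _ hR =>
    isCompactOperator_of_isResolvent_multiplier hF hR⟩

lemma IsPhasedPushforward.hasBoundedCommutator_multiplier [AddCommGroup G] {h : G}
    {W : L2 G S →L[ℂ] L2 G S} (hW : IsPhasedPushforward (h + ·) W)
    (hF : BoundedTranslationIncrements F) : HasBoundedCommutator (multiplier F) W := by
  obtain ⟨b, hb⟩ := hF h
  have hbound (g : G) : ‖(F (g + h) : S →L[ℂ] S) - (F g : S →L[ℂ] S)‖ ≤ b := hb ⟨g, rfl⟩
  let T : L2 G S →L[ℂ] L2 G S := lp.mapCLM 2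
    (fun g => (F (g + h) : S →L[ℂ] S) - (F g : S →L[ℂ] S))
    ((norm_nonneg _).trans (hbound 0)) hbound
  refine ⟨W ∘L T, fun η ζ hηζ => ?_⟩
  rw [ContinuousLinearMap.comp_apply, ← map_add]
  refine hW.map_mem_graph_multiplier (add_right_injective h) (mem_graph_multiplier.2 fun g => ?_)
  rw [lp.coeFn_add, Pi.add_apply, mem_graph_multiplier.1 hηζ, Function.comp_apply, add_comm h g]
  exact add_sub_cancel ((F g : S →L[ℂ] S) (η g)) ((F (g + h) : S →L[ℂ] S) (η g))

end Multiplier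

/-! ### The inductive limit of the Dirac operators -/

section LimitOperator

variable {H : ℕ → Type} [∀ n, NormedAddCommGroup (H n)] [∀ n, InnerProductSpace ℂ (H n)]
  {I : ∀ n, H n →ₗᵢ[ℂ] H (n + 1)} {D : ∀ n, H n →ₗ.[ℂ] H n}

lemma toHilbertLimit_mem_limitGraph {n : ℕ} {η ζ : H n} (h : (η, ζ) ∈ (D n).graph) :
    (toHilbertLimit I n η, toHilbertLimit I n ζ) ∈ limitGraph I D :=
  Submodule.mem_iSup_of_mem n ⟨(η, ζ), h, rfl⟩

variable {E : Type*} [NormedAddCommGroup E] [InnerProductSpace ℂ E] {V : HilbertLimit I ≃ₗᵢ[ℂ] E}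
  {D' : E →ₗ.[ℂ] E}

lemma snd_eq_zero_of_mem_topologicalClosure_limitGraph
    (h : ∀ η ζ, (η, ζ) ∈ (limitGraph I D).topologicalClosure ↔ (V η, V ζ) ∈ D'.graph)
    (x : HilbertLimit I × HilbertLimit I) (hx : x ∈ (limitGraph I D).topologicalClosure)
    (hx₁ : x.1 = 0) : x.2 = 0 :=
  (LinearIsometryEquiv.map_eq_zero_iff V).1
    (D'.graph_fst_eq_zero_snd ((h _ _).1 hx) (by rw [hx₁, map_zero]))

lemma limitOperatorWellDefined_of_closure (hD : ∀ n, Dense ((D n).domain : Set (H n)))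
    (h : ∀ η ζ, (η, ζ) ∈ (limitGraph I D).topologicalClosure ↔ (V η, V ζ) ∈ D'.graph) :
    LimitOperatorWellDefined I D := by
  have hsingle := snd_eq_zero_of_mem_topologicalClosure_limitGraph h
  have hgraph : (limitCoreOperator I D).graph = limitGraph I D :=
    Submodule.toLinearPMap_graph_eq _ fun x hx =>
      hsingle x (Submodule.le_topologicalClosure _ hx)
  refine ⟨hgraph, ?_, (limitGraph I D).topologicalClosure.toLinearPMap, ?_⟩
  · rw [Submodule.dense_iff_topologicalClosure_eq_top, eq_top_iff]
    refine fun z _ => mem_of_toHilbertLimit_mem (Submodule.isClosed_topologicalClosure _) 0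
      (fun n _ η => ?_) z
    refine map_mem_closure (toHilbertLimit I n).continuous (hD n η) fun ξ hξ => ?_
    exact LinearPMap.mem_domain_of_mem_graph
      (hgraph ▸ toHilbertLimit_mem_limitGraph ((D n).mem_graph ⟨ξ, hξ⟩))
  · rw [hgraph, Submodule.toLinearPMap_graph_eq _ hsingle]

lemma unitarilyEquivalent_limitOperator_of_closure (hD : ∀ n, Dense ((D n).domain : Set (H n)))
    (h : ∀ η ζ, (η, ζ) ∈ (limitGraph I D).topologicalClosure ↔ (V η, V ζ) ∈ D'.graph) :
    UnitarilyEquivalent V (limitOperator I D) D' := by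
  have hwell := limitOperatorWellDefined_of_closure hD h
  intro η ζ
  rw [limitOperator, ← hwell.2.2.graph_closure_eq_closure_graph, hwell.1, h]

end LimitOperator

section LimitMultiplier

variable {X : ℕ → Type} {G S : Type} [NormedAddCommGroup S] [InnerProductSpace ℂ S]
  [CompleteSpace S] {I : ∀ n, L2 (X n) S →ₗᵢ[ℂ] L2 (X (n + 1)) S}
  {V : HilbertLimit I ≃ₗᵢ[ℂ] L2 G S} {f : ∀ n, X n → G} {F : G → selfAdjoint (S →L[ℂ] S)}

lemma mem_graph_multiplier_of_mem_topologicalClosure_limitGraph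
    (hV : ∀ n, IsPhasedPushforward (f n) ((V : HilbertLimit I →L[ℂ] L2 G S) ∘L
      (toHilbertLimit I n).toContinuousLinearMap))
    (hf : ∀ n, Function.Injective (f n)) {η ζ : HilbertLimit I}
    (h : (η, ζ) ∈ (limitGraph I fun n => multiplier (F ∘ f n)).topologicalClosure) :
    (V η, V ζ) ∈ (multiplier F).graph := by
  suffices hle : (limitGraph I fun n => multiplier (F ∘ f n)).topologicalClosure ≤
      (multiplier F).graph.comap (V.toLinearMap.prodMap V.toLinearMap) from hle h
  refine Submodule.topologicalClosure_minimal _ (iSup_le fun n => ?_)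
    ((isClosed_graph_multiplier F).preimage (V.continuous.prodMap V.continuous))
  rintro _ ⟨⟨ξ, ξ'⟩, hξ, rfl⟩
  exact (hV n).map_mem_graph_multiplier (hf n) hξ

lemma mem_topologicalClosure_limitGraph_of_mem_graph_multiplier
    (hV : ∀ n, IsPhasedPushforward (f n) ((V : HilbertLimit I →L[ℂ] L2 G S) ∘L
      (toHilbertLimit I n).toContinuousLinearMap))
    (hf : ∀ g, ∃ n x, f n x = g) {η ζ : HilbertLimit I} (h : (V η, V ζ) ∈ (multiplier F).graph) :
    (η, ζ) ∈ (limitGraph I fun n => multiplier (F ∘ f n)).topologicalClosure := by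
  set K := (limitGraph I fun n => multiplier (F ∘ f n)).topologicalClosure
  have hK : IsClosed (K : Set (HilbertLimit I × HilbertLimit I)) :=
    Submodule.isClosed_topologicalClosure _
  suffices hle : (multiplier F).graph ≤
      K.comap (V.symm.toLinearMap.prodMap V.symm.toLinearMap) by
    have hsymm : (V.symm (V η), V.symm (V ζ)) ∈ K := hle h
    rwa [V.symm_apply_apply, V.symm_apply_apply] at hsymm
  refine graph_multiplier_le F (hK.preimage (V.symm.continuous.prodMap V.symm.continuous))
    fun g ξ => ?_
  obtain ⟨n, x, rfl⟩ := hf g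
  obtain ⟨c, hc⟩ := hV n x
  have hsymm (ξ : S) : V.symm (delta (f n x) ξ) = (c⁻¹ : ℂ) • toHilbertLimit I n (delta x ξ) := by
    have hVc : V (toHilbertLimit I n (delta x ξ)) = (c : ℂ) • delta (f n x) ξ := hc ξ
    rw [V.symm_apply_eq, map_smul, hVc, inv_smul_smul₀ c.coe_ne_zero]
  change (V.symm (delta (f n x) ξ), V.symm (delta (f n x) ((F (f n x) : S →L[ℂ] S) ξ))) ∈ K
  rw [hsymm, hsymm, ← Prod.smul_mk]
  exact K.smul_mem _ (Submodule.le_topologicalClosure _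
    (toHilbertLimit_mem_limitGraph (delta_mem_graph_multiplier (F ∘ f n) x ξ)))

theorem limitOperator_multiplier
    (hV : ∀ n, IsPhasedPushforward (f n) ((V : HilbertLimit I →L[ℂ] L2 G S) ∘L
      (toHilbertLimit I n).toContinuousLinearMap))
    (hf : ∀ n, Function.Injective (f n)) (hf' : ∀ g, ∃ n x, f n x = g) :
    LimitOperatorWellDefined I (fun n => multiplier (F ∘ f n)) ∧
      UnitarilyEquivalent V (limitOperator I fun n => multiplier (F ∘ f n)) (multiplier F) := by
  have hdense n := dense_domain_multiplier (F ∘ f n)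
  have hclosure (η ζ : HilbertLimit I) :
      (η, ζ) ∈ (limitGraph I fun n => multiplier (F ∘ f n)).topologicalClosure ↔
        (V η, V ζ) ∈ (multiplier F).graph :=
    ⟨mem_graph_multiplier_of_mem_topologicalClosure_limitGraph hV hf,
      mem_topologicalClosure_limitGraph_of_mem_graph_multiplier hV hf'⟩
  exact ⟨limitOperatorWellDefined_of_closure hdense hclosure,
    unitarilyEquivalent_limitOperator_of_closure hdense hclosure⟩

end LimitMultiplier

/-! ### Operators on the Hilbert space inductive limit -/

section LimitOperators

variable {H : ℕ → Type} [∀ n, NormedAddCommGroup (H n)] [∀ n, InnerProductSpace ℂ (H n)]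
  {I : ∀ n, H n →ₗᵢ[ℂ] H (n + 1)}

section Maps

variable {E : Type*} [NormedAddCommGroup E] [NormedSpace ℂ E]

lemma exists_limit_map [CompleteSpace E] {f : ∀ n, H n →L[ℂ] E}
    (hf : ∀ n k (h : n ≤ k) η, f n η = f k (isometryTransition I n k h η)) {C : ℝ}
    (hC : ∀ n, ‖f n‖ ≤ C) :
    ∃ T : HilbertLimit I →L[ℂ] E, ∀ n η, T (toHilbertLimit I n η) = f n η := by
  let lift : PreHilbertLimit I →ₗ[ℂ] E :=
    { toFun := DirectLimit.lift (isometryTransition I) (fun n η => f n η) hf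
      map_add' := fun x y => by
        obtain ⟨n, η, ζ, rfl, rfl⟩ := DirectLimit.exists_eq_mk₂ (isometryTransition I) x y
        exact (congrArg _ (map_add (toPreHilbertLimit I n) η ζ).symm).trans (map_add (f n) η ζ)
      map_smul' := fun c x => by
        obtain ⟨n, η, rfl⟩ := DirectLimit.exists_eq_mk (isometryTransition I) x
        exact (congrArg _ (map_smul (toPreHilbertLimit I n) c η).symm).trans (map_smul (f n) c η) }
  refine ⟨lift.extendOfNorm (UniformSpace.Completion.toComplₗᵢ (𝕜 := ℂ)).toLinearMap,
    fun n η => LinearMap.extendOfNorm_eq UniformSpace.Completion.denseRange_coe ⟨C, fun x => ?_⟩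
      (toPreHilbertLimit I n η)⟩
  obtain ⟨k, ζ, rfl⟩ := DirectLimit.exists_eq_mk (isometryTransition I) x
  change ‖f k ζ‖ ≤ C * ‖toHilbertLimit I k ζ‖
  rw [LinearIsometry.norm_map]
  exact (f k).le_of_opNorm_le (hC k) ζ

lemma apply_isometryTransition_of_step {n : ℕ} {f : ∀ k, n ≤ k → H k →L[ℂ] E}
    (hf : ∀ k h η, f k h η = f (k + 1) (Nat.le_succ_of_le h) (I k η)) {k l : ℕ} (h : n ≤ k)
    (h' : k ≤ l) (η : H k) : f l (h.trans h') (isometryTransition I k l h' η) = f k h η := by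
  induction l, h' using Nat.le_induction with
  | base => simp [isometryTransition]
  | succ l h' ih =>
    rw [isometryTransition_succ I k l h', ← ih, hf l]
    rfl

lemma exists_limit_map_of_late_stages [CompleteSpace E] {n : ℕ} {f : ∀ k, n ≤ k → H k →L[ℂ] E}
    (hf : ∀ k h η, f k h η = f (k + 1) (Nat.le_succ_of_le h) (I k η)) {C : ℝ}
    (hC : ∀ k h, ‖f k h‖ ≤ C) :
    ∃ T : HilbertLimit I →L[ℂ] E, ∀ k h η, T (toHilbertLimit I k η) = f k h η := by
  let g (k : ℕ) : H k →L[ℂ] E := f (max n k) (le_max_left n k) ∘L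
    (isometryTransition I k (max n k) (le_max_right n k)).toContinuousLinearMap
  have hg (k l : ℕ) (h : k ≤ l) (η : H k) : g k η = g l (isometryTransition I k l h η) := by
    change f _ _ (isometryTransition I k _ _ η) = f _ _ (isometryTransition I l _ _ _)
    rw [← apply_isometryTransition_of_step hf _ (max_le_max le_rfl h)]
    congr 1
    exact (DirectedSystem.map_map' (isometryTransition I) _ _ η).trans
      (DirectedSystem.map_map' (isometryTransition I) _ _ η).symm
  have hgC (k : ℕ) : ‖g k‖ ≤ C := by
    refine ContinuousLinearMap.opNorm_le_bound _ ((norm_nonneg _).trans (hC n le_rfl)) fun η => ?_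
    rw [← LinearIsometry.norm_map (isometryTransition I k (max n k) (le_max_right n k)) η]
    exact (f _ _).le_of_opNorm_le (hC _ _) _
  obtain ⟨T, hT⟩ := exists_limit_map hg hgC
  exact ⟨T, fun k h η => (hT k η).trans
    (apply_isometryTransition_of_step hf h (le_max_right n k) η)⟩

end Maps

lemma exists_limit_operator {n : ℕ} {B : ∀ k, n ≤ k → H k →L[ℂ] H k}
    (hB : ∀ k h η, I k (B k h η) = B (k + 1) (Nat.le_succ_of_le h) (I k η)) {C : ℝ}
    (hC : ∀ k h, ‖B k h‖ ≤ C) :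
    ∃ T : HilbertLimit I →L[ℂ] HilbertLimit I,
      ∀ k (h : n ≤ k) η, T (toHilbertLimit I k η) = toHilbertLimit I k (B k h η) := by
  refine exists_limit_map_of_late_stages (C := C)
    (f := fun k h => (toHilbertLimit I k).toContinuousLinearMap ∘L B k h) (fun k h η => ?_)
    fun k h => ((toHilbertLimit I k).norm_toContinuousLinearMap_comp).trans_le (hC k h)
  change toHilbertLimit I k (B k h η) = toHilbertLimit I (k + 1) (B (k + 1) _ (I k η))
  rw [← hB k h, ← toHilbertLimit_transition I (Nat.le_succ k), isometryTransition_succ I k k le_rfl]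
  simp [isometryTransition]

lemma inner_apply_eq_of_late_stages {n : ℕ} {T T' : HilbertLimit I →L[ℂ] HilbertLimit I}
    (h : ∀ k, n ≤ k → ∀ η ζ : H k, inner ℂ (T' (toHilbertLimit I k η)) (toHilbertLimit I k ζ) =
      inner ℂ (toHilbertLimit I k η) (T (toHilbertLimit I k ζ))) (x y : HilbertLimit I) :
    inner ℂ (T' x) y = inner ℂ x (T y) := by
  have inner_of_stage (k : ℕ) (hk : n ≤ k) (η : H k) (y : HilbertLimit I) :
      inner ℂ (T' (toHilbertLimit I k η)) y = inner ℂ (toHilbertLimit I k η) (T y) := by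
    refine DFunLike.congr_fun (f := innerSL ℂ (T' (toHilbertLimit I k η)))
      (g := innerSL ℂ (toHilbertLimit I k η) ∘L T) (ext_toHilbertLimit k fun l hl ζ => ?_) y
    change inner ℂ (T' (toHilbertLimit I k η)) (toHilbertLimit I l ζ) =
      inner ℂ (toHilbertLimit I k η) (T (toHilbertLimit I l ζ))
    rw [← toHilbertLimit_transition I hl η]
    exact h l (hk.trans hl) _ ζ
  suffices hswap : innerSL ℂ y ∘L T' = innerSL ℂ (T y) by
    rw [← inner_conj_symm, ← inner_conj_symm x]
    exact congrArg _ (DFunLike.congr_fun hswap x)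
  refine ext_toHilbertLimit n fun k hk η => ?_
  change inner ℂ y (T' (toHilbertLimit I k η)) = inner ℂ (T y) (toHilbertLimit I k η)
  rw [← inner_conj_symm, inner_of_stage k hk, inner_conj_symm]

end LimitOperators

/-! ### The C*-algebra inductive limit and its representations -/

section CStarLimit

variable {A : ℕ → Type*} [∀ n, CStarAlgebra (A n)] (φ : ∀ n, A n →⋆ₐ[ℂ] A (n + 1))

/-- The connecting homomorphism `φ_{k-1} ∘ ⋯ ∘ φ_n : A_n → A_k` of the inductive system. -/
def homTransition (n k : ℕ) (h : n ≤ k) : A n →⋆ₐ[ℂ] A k :=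
  Nat.leRec (motive := fun k _ => A n →⋆ₐ[ℂ] A k) (StarAlgHom.id ℂ (A n))
    (fun k _ f => (φ k).comp f) h

lemma homTransition_self (n : ℕ) (a : A n) : homTransition φ n n le_rfl a = a := by
  simp [homTransition]

lemma homTransition_succ (n k : ℕ) (h : n ≤ k) (h' : n ≤ k + 1) (a : A n) :
    homTransition φ n (k + 1) h' a = φ k (homTransition φ n k h a) :=
  DFunLike.congr_fun (Nat.leRec_succ (motive := fun k _ => A n →⋆ₐ[ℂ] A k) _ _ h) a

lemma homTransition_apply_step (n k : ℕ) (h : n + 1 ≤ k) (a : A n) :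
    homTransition φ (n + 1) k h (φ n a) = homTransition φ n k (Nat.le_of_succ_le h) a := by
  induction k, h using Nat.le_induction with
  | base => rw [homTransition_self, homTransition_succ φ n n le_rfl, homTransition_self]
  | succ k h ih =>
    rw [homTransition_succ φ _ k h, ih, homTransition_succ φ n k (Nat.le_of_succ_le h)]

lemma toCStarLimit_homTransition (n k : ℕ) (h : n ≤ k) (a : A n) :
    toCStarLimit φ k (homTransition φ n k h a) = toCStarLimit φ n a := by
  induction k, h using Nat.le_induction with
  | base => rw [homTransition_self]
  | succ k h ih => rw [homTransition_succ φ n k h, toCStarLimit_comp, ih]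

lemma dense_iUnion_range_toCStarLimit : Dense (⋃ n, Set.range (toCStarLimit φ n)) := by
  have hmono : Monotone fun n => (toCoconeProd φ n).range := by
    refine monotone_nat_of_le_succ fun n => ?_
    rintro _ ⟨a, rfl⟩
    exact ⟨φ n a, congrArg Subtype.val (toCStarLimit_comp φ n a)⟩
  intro x
  rw [Topology.IsInducing.subtypeVal.closure_eq_preimage_closure_image]
  have hx : (x : lp (fun c : CStarCocone φ => c.B) ∞) ∈
      closure ((⨆ n, (toCoconeProd φ n).range : StarSubalgebra ℂ _) : Set _) := x.2
  rw [StarSubalgebra.coe_iSup_of_directed hmono.directed_le] at hx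
  refine closure_mono (fun y hy => ?_) hx
  obtain ⟨n, a, rfl⟩ := Set.mem_iUnion.1 hy
  exact ⟨toCStarLimit φ n a, Set.mem_iUnion.2 ⟨n, a, rfl⟩, rfl⟩

variable {φ}

lemma starAlgHom_ext_toCStarLimit {B : Type*} [CStarAlgebra B] {f g : CStarLimit φ →⋆ₐ[ℂ] B}
    (h : ∀ n a, f (toCStarLimit φ n a) = g (toCStarLimit φ n a)) : f = g := by
  have heqOn : Set.EqOn (starHomCLM f) (starHomCLM g) (⋃ n, Set.range (toCStarLimit φ n)) := by
    intro x hx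
    obtain ⟨n, a, rfl⟩ := Set.mem_iUnion.1 hx
    exact h n a
  ext x : 1
  exact congrFun ((starHomCLM f).continuous.ext_on (dense_iUnion_range_toCStarLimit φ)
    (starHomCLM g).continuous heqOn) x

lemma exists_starAlgHom_of_cocone (c : CStarCocone φ) :
    ∃ f : CStarLimit φ →⋆ₐ[ℂ] c.B, ∀ n a, f (toCStarLimit φ n a) = c.ψ n a := by
  let eval : lp (fun c : CStarCocone φ => c.B) ∞ →⋆ₐ[ℂ] c.B :=
    { toFun := fun b => b c
      map_one' := rfl
      map_mul' := fun _ _ => rfl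
      map_zero' := rfl
      map_add' := fun _ _ => rfl
      commutes' := fun _ => rfl
      map_star' := fun _ => rfl }
  exact ⟨eval.comp (CStarLimit φ).subtype, fun _ _ => rfl⟩

variable {H : ℕ → Type} [∀ n, NormedAddCommGroup (H n)] [∀ n, InnerProductSpace ℂ (H n)]
  [∀ n, CompleteSpace (H n)] {I : ∀ n, H n →ₗᵢ[ℂ] H (n + 1)}
  {ρ : ∀ n, A n →⋆ₐ[ℂ] (H n →L[ℂ] H n)}

lemma exists_stage_rep (hρ : ∀ n a η, I n (ρ n a η) = ρ (n + 1) (φ n a) (I n η)) (n : ℕ) :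
    ∃ ψ : A n →⋆ₐ[ℂ] (HilbertLimit I →L[ℂ] HilbertLimit I), ∀ a k (h : n ≤ k) η,
      ψ a (toHilbertLimit I k η) = toHilbertLimit I k (ρ k (homTransition φ n k h a) η) := by
  have hex (a : A n) := exists_limit_operator (I := I) (n := n) (C := ‖a‖)
    (B := fun k h => ρ k (homTransition φ n k h a))
    (fun k h η => by rw [hρ, homTransition_succ φ n k h])
    fun k h => (NonUnitalStarAlgHom.norm_apply_le (ρ k) _).trans
      (NonUnitalStarAlgHom.norm_apply_le (homTransition φ n k h) a)
  choose ψ hψ using hex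
  have hadjoint (a : A n) : ψ (star a) = star (ψ a) := by
    rw [ContinuousLinearMap.star_eq_adjoint, ContinuousLinearMap.eq_adjoint_iff]
    refine inner_apply_eq_of_late_stages (n := n) fun k h η ζ => ?_
    rw [hψ _ k h, hψ _ k h, LinearIsometry.inner_map_map, LinearIsometry.inner_map_map, map_star,
      map_star, ContinuousLinearMap.star_eq_adjoint, ContinuousLinearMap.adjoint_inner_left]
  refine ⟨
    { toFun := ψ
      map_one' := ext_toHilbertLimit n fun k h η => by
        rw [hψ _ k h, map_one, map_one]; rfl
      map_mul' := fun a b => ext_toHilbertLimit n fun k h η => by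
        rw [mul_apply_eq_comp, hψ _ k h, map_mul, map_mul, hψ _ k h, hψ _ k h]; rfl
      map_zero' := ext_toHilbertLimit n fun k h η => by
        rw [hψ _ k h, map_zero, map_zero, zero_apply, zero_apply, map_zero]
      map_add' := fun a b => ext_toHilbertLimit n fun k h η => by
        rw [hψ _ k h, map_add, map_add, add_apply, add_apply, hψ _ k h, hψ _ k h, map_add]
      commutes' := fun c => ext_toHilbertLimit n fun k h η => by
        rw [hψ _ k h, AlgHomClass.commutes (homTransition φ n k h) c, AlgHomClass.commutes (ρ k) c,
          Algebra.algebraMap_eq_smul_one, Algebra.algebraMap_eq_smul_one]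
        exact map_smul (toHilbertLimit I k) c η
      map_star' := hadjoint }, hψ⟩

theorem existsUnique_limit_rep [Nontrivial (H 0)]
    (hρ : ∀ n a η, I n (ρ n a η) = ρ (n + 1) (φ n a) (I n η)) :
    ∃! π : CStarLimit φ →⋆ₐ[ℂ] (HilbertLimit I →L[ℂ] HilbertLimit I), ∀ n (a : A n) (η : H n),
      π (toCStarLimit φ n a) (toHilbertLimit I n η) = toHilbertLimit I n (ρ n a η) := by
  have : Nontrivial (HilbertLimit I) := (toHilbertLimit I 0).injective.nontrivial
  choose ψ hψ using exists_stage_rep hρ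
  obtain ⟨π, hπ⟩ := exists_starAlgHom_of_cocone
    { B := HilbertLimit I →L[ℂ] HilbertLimit I
      ψ := ψ
      compat := fun n a => ext_toHilbertLimit (n + 1) fun k h η => by
        rw [hψ _ _ k h, homTransition_apply_step, hψ _ _ k (Nat.le_of_succ_le h)] }
  refine ⟨π, fun n a η => ?_, fun π' hπ' => starAlgHom_ext_toCStarLimit fun n a => ?_⟩
  · rw [hπ, hψ n a n le_rfl, homTransition_self]
  · refine ext_toHilbertLimit n fun k h η => ?_
    rw [hπ, hψ n a k h, ← toCStarLimit_homTransition φ n k h, hπ']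

theorem limit_rep_injective (hinj : ∀ n, Function.Injective (ρ n))
    {π : CStarLimit φ →⋆ₐ[ℂ] (HilbertLimit I →L[ℂ] HilbertLimit I)}
    (hπ : ∀ n (a : A n) (η : H n),
      π (toCStarLimit φ n a) (toHilbertLimit I n η) = toHilbertLimit I n (ρ n a η)) :
    Function.Injective π := by
  have hnorm (x : CStarLimit φ) : ‖x‖ ≤ ‖starHomCLM π x‖ := by
    refine (dense_iUnion_range_toCStarLimit φ).induction
      (P := fun x => ‖x‖ ≤ ‖starHomCLM π x‖) (fun x hx => ?_)
      (isClosed_le continuous_norm (starHomCLM π).continuous.norm) x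
    obtain ⟨n, a, rfl⟩ := Set.mem_iUnion.1 hx
    refine (NonUnitalStarAlgHom.norm_apply_le (toCStarLimit φ n) a).trans ?_
    rw [← NonUnitalStarAlgHom.norm_map (ρ n) (hinj n) a]
    refine ContinuousLinearMap.opNorm_le_bound _ (norm_nonneg _) fun η => ?_
    rw [← LinearIsometry.norm_map (toHilbertLimit I n), ← hπ,
      ← LinearIsometry.norm_map (toHilbertLimit I n) η]
    exact (π (toCStarLimit φ n a)).le_opNorm _
  rw [injective_iff_map_eq_zero]
  intro x hx
  refine norm_le_zero_iff.1 ((hnorm x).trans_eq ?_)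
  exact norm_eq_zero.2 hx

end CStarLimit

/-! ### The inductive realization -/

lemma dense_boundedCommutators_of_total {A X : ℕ → Type*} {B H : Type*} [∀ n, CStarAlgebra (A n)]
    [CStarAlgebra B] [NormedAddCommGroup H] [InnerProductSpace ℂ H] [CompleteSpace H]
    {ι : ∀ n, A n →⋆ₐ[ℂ] B} (hι : Dense (⋃ n, Set.range (ι n))) {u : ∀ n, X n → A n}
    (hu : ∀ n, Dense (Submodule.span ℂ (Set.range (u n)) : Set (A n)))
    {π : B →⋆ₐ[ℂ] (H →L[ℂ] H)} {D : H →ₗ.[ℂ] H} (hD : Dense (D.domain : Set H))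
    (h : ∀ n x, HasBoundedCommutator D (π (ι n (u n x)))) : Dense (boundedCommutators π D) := by
  refine Dense.mono (smoothElements_subset_boundedCommutators π hD)
    (dense_closure.1 (hι.mono (Set.iUnion_subset fun n => ?_)))
  rintro _ ⟨a, rfl⟩
  have hspan : Submodule.span ℂ (Set.range (u n)) ≤
      (smoothElements π D).comap (starHomCLM (ι n)).toLinearMap := by
    rw [Submodule.span_le]
    rintro _ ⟨x, rfl⟩
    exact h n x
  exact map_mem_closure (starHomCLM (ι n)).continuous (hu n a) hspan

namespace ToricSystem

variable {T : ToricSystem} {S : Type} [NormedAddCommGroup S] [InnerProductSpace ℂ S]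
  [CompleteSpace S] {I : ∀ n, T.H S n →ₗᵢ[ℂ] T.H S (n + 1)}

/-- `D` is the diagonal operator of `F` in the labels: a unitary of the limit Hilbert space onto
`ℓ²(G_∞) ⊗ S` sends each `δ_x ⊗ ξ` of stage `n` to a phase times `δ_{[x,n]} ⊗ ξ`, and `D` to
`D_F`. -/
def IsLabelDiagonal (D : HilbertLimit I →ₗ.[ℂ] HilbertLimit I)
    (F : T.G → selfAdjoint (S →L[ℂ] S)) : Prop :=
  ∃ (V : HilbertLimit I ≃ₗᵢ[ℂ] L2 T.G S) (χ : ∀ n, T.Label n → Circle),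
    (∀ n (x : T.Label n) (ξ : S),
      V (toHilbertLimit I n (delta x ξ)) = (χ n x : ℂ) • delta (T.label n x) ξ) ∧
    UnitarilyEquivalent V D (multiplier F)

section UnitaryLabels

variable {A : ℕ → Type*} {B : Type*} [∀ n, CStarAlgebra (A n)] [CStarAlgebra B]
  {φ : ∀ n, A n →⋆ₐ[ℂ] A (n + 1)} {u : ∀ n, T.Label n → A n} {ι : ∀ n, A n →⋆ₐ[ℂ] B}

lemma exists_eq_smul_labelTransition
    (hu : ∀ n x, ∃ c : Circle, φ n (u n x) = (c : ℂ) • u (n + 1) ((T.M n).mulVec x))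
    (hι : ∀ n a, ι (n + 1) (φ n a) = ι n a) {n k : ℕ} (h : n ≤ k) (x : T.Label n) :
    ∃ c : Circle, ι n (u n x) = (c : ℂ) • ι k (u k (T.labelTransition n k h x)) := by
  induction k, h using Nat.le_induction with
  | base => exact ⟨1, by simp [labelTransition]⟩
  | succ k h ih =>
    obtain ⟨c, hc⟩ := ih
    obtain ⟨c', hc'⟩ := hu k (T.labelTransition n k h x)
    refine ⟨c * c', ?_⟩
    rw [hc, ← hι, hc', map_smul, smul_smul, Circle.coe_mul, T.labelTransition_succ n k h]
    rfl

variable {V : HilbertLimit I ≃ₗᵢ[ℂ] L2 T.G S} {χ : ∀ n, T.Label n → Circle}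
  {ρ : ∀ n, A n →⋆ₐ[ℂ] (T.H S n →L[ℂ] T.H S n)}

lemma isPhasedPushforward_limit_rep
    (hu : ∀ n x, ∃ c : Circle, φ n (u n x) = (c : ℂ) • u (n + 1) ((T.M n).mulVec x))
    (hι : ∀ n a, ι (n + 1) (φ n a) = ι n a)
    (hρ : ∀ n x, IsPhasedPushforward (x + ·) (ρ n (u n x)))
    {π : B →⋆ₐ[ℂ] (HilbertLimit I →L[ℂ] HilbertLimit I)}
    (hπ : ∀ n a η, π (ι n a) (toHilbertLimit I n η) = toHilbertLimit I n (ρ n a η))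
    (hV : ∀ n (x : T.Label n) (ξ : S),
      V (toHilbertLimit I n (delta x ξ)) = (χ n x : ℂ) • delta (T.label n x) ξ)
    (n : ℕ) (x : T.Label n) : IsPhasedPushforward (T.label n x + ·)
      (V.toContinuousLinearEquiv.conjContinuousAlgEquiv (π (ι n (u n x)))) := by
  intro g
  obtain ⟨l, y₀, rfl⟩ := T.exists_label g
  obtain ⟨k, hnk, hlk⟩ := exists_ge_ge n l
  set y := T.labelTransition l k hlk y₀
  obtain ⟨c, hc⟩ := exists_eq_smul_labelTransition hu hι hnk x
  obtain ⟨q, hq⟩ := hρ k (T.labelTransition n k hnk x) y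
  refine ⟨(χ k y)⁻¹ * (c * (q * χ k (T.labelTransition n k hnk x + y))), fun ξ => ?_⟩
  have hVsymm : V.symm (delta (T.label l y₀) ξ) =
      (((χ k y)⁻¹ : Circle) : ℂ) • toHilbertLimit I k (delta y ξ) := by
    rw [V.symm_apply_eq, map_smul, hV, T.label_transition, smul_smul, ← Circle.coe_mul,
      inv_mul_cancel, Circle.coe_one, one_smul]
  have hπc := map_smul π (c : ℂ) (ι k (u k (T.labelTransition n k hnk x)))
  change V (π (ι n (u n x)) (V.symm (delta (T.label l y₀) ξ))) = _
  rw [hVsymm, hc, hπc, map_smul, smul_apply, hπ, hq, map_smul, map_smul, map_smul, map_smul, hV,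
    T.label_add, T.label_transition, T.label_transition]
  simp only [smul_smul, Circle.coe_mul]

lemma isSpectralTriple_cstarLimit [Nontrivial S]
    (hu : ∀ n x, ∃ c : Circle, φ n (u n x) = (c : ℂ) • u (n + 1) ((T.M n).mulVec x))
    (hdense : ∀ n, Dense (Submodule.span ℂ (Set.range (u n)) : Set (A n)))
    (hρ : ∀ n x, IsPhasedPushforward (x + ·) (ρ n (u n x)))
    (hinj : ∀ n, Function.Injective (ρ n))
    {π : CStarLimit φ →⋆ₐ[ℂ] (HilbertLimit I →L[ℂ] HilbertLimit I)}
    (hπ : ∀ n (a : A n) (η : T.H S n),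
      π (toCStarLimit φ n a) (toHilbertLimit I n η) = toHilbertLimit I n (ρ n a η))
    {D : HilbertLimit I →ₗ.[ℂ] HilbertLimit I} {F : T.G → selfAdjoint (S →L[ℂ] S)}
    (hD : IsLabelDiagonal D F) (hF_mult : FiniteSpectralMultiplicity F)
    (hF_incr : BoundedTranslationIncrements F) :
    IsSpectralTriple (A := CStarLimit φ) π D := by
  obtain ⟨V, χ, hV, hD⟩ := hD
  have : Nonempty T.G := ⟨T.label 0 0⟩
  have := hF_mult.finiteDimensional
  have hdomain := hD.dense_domain (dense_domain_multiplier F)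
  exact
    { faithful := limit_rep_injective hinj hπ
      dense_domain := hdomain
      selfAdjoint := hD.isSelfAdjoint (isSelfAdjoint_multiplier F)
      compactResolvent := hD.hasCompactResolvent (hasCompactResolvent_multiplier hF_mult)
      dense_boundedCommutators :=
        dense_boundedCommutators_of_total (dense_iUnion_range_toCStarLimit φ) hdense hdomain
          fun n x => hD.hasBoundedCommutator
            ((isPhasedPushforward_limit_rep hu (toCStarLimit_comp φ) hρ hπ hV n
              x).hasBoundedCommutator_multiplier hF_incr) }

end UnitaryLabels

variable [Nontrivial S]

theorem IsGNSIsometry.isLabelDiagonal_limitOperator (hI : T.IsGNSIsometry I)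
    {F : ∀ n, T.Label n → selfAdjoint (S →L[ℂ] S)} {Finf : T.G → selfAdjoint (S →L[ℂ] S)}
    (hFinf : ∀ n (x : T.Label n), Finf (T.label n x) = F n x) :
    LimitOperatorWellDefined I (fun n => multiplier (F n)) ∧
      IsLabelDiagonal (limitOperator I fun n => multiplier (F n)) Finf := by
  obtain rfl : (fun n => Finf ∘ T.label n) = F := funext fun n => funext (hFinf n)
  obtain ⟨V, χ, hV⟩ := hI.exists_unitary
  obtain ⟨hwell, hD⟩ := limitOperator_multiplier (F := Finf) (fun n x => ⟨χ n x, hV n x⟩)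
    T.label_injective T.exists_label
  exact ⟨hwell, V, χ, hV, hD⟩

theorem IsGNSIsometry.existsUnique_isLimitRep (hI : T.IsGNSIsometry I) :
    ∃! π : T.Apro →⋆ₐ[ℂ] (HilbertLimit I →L[ℂ] HilbertLimit I), T.IsLimitRep I π := by
  have : Nontrivial (T.H S 0) := (deltaIsometry S (0 : T.Label 0)).injective.nontrivial
  exact existsUnique_limit_rep (φ := T.φ) (ρ := T.π S) hI.map_π

theorem IsLimitRep.isSpectralTriple
    {π : T.Apro →⋆ₐ[ℂ] (HilbertLimit I →L[ℂ] HilbertLimit I)} (hπ : T.IsLimitRep I π)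
    {D : HilbertLimit I →ₗ.[ℂ] HilbertLimit I} {F : T.G → selfAdjoint (S →L[ℂ] S)}
    (hD : IsLabelDiagonal D F) (hF_mult : FiniteSpectralMultiplicity F)
    (hF_incr : BoundedTranslationIncrements F) :
    IsSpectralTriple (A := T.Apro) π D :=
  isSpectralTriple_cstarLimit (φ := T.φ) (ρ := T.π S) (u := fun n => NCTorus.mono (T.Θ n))
    (fun n => exists_toricHom_mono (T.z n) (T.congruence n))
    (fun n => NCTorus.dense_span_mono (T.Θ n))
    (fun n => isPhasedPushforward_regularRep S (T.skew n))
    (fun n => regularRep_injective (T.skew n)) hπ hD hF_mult hF_incr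

end ToricSystem

end Protorus

end

open Protorus in
theorem mainTheorem11_general (T : ToricSystem)
    (S : Type) [NormedAddCommGroup S] [InnerProductSpace ℂ S] [CompleteSpace S] [Nontrivial S]
    (F : ∀ n, T.Label n → selfAdjoint (S →L[ℂ] S))
    (hF_compat : ∀ n (x : T.Label n), F (n + 1) ((T.M n).mulVec x) = F n x) :
    ∃ Finf : T.G → selfAdjoint (S →L[ℂ] S),
      (∀ n (x : T.Label n), Finf (T.label n x) = F n x) ∧
      (∃! I : ∀ n, T.H S n →ₗᵢ[ℂ] T.H S (n + 1), T.IsGNSIsometry I) ∧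
      ∀ I : ∀ n, T.H S n →ₗᵢ[ℂ] T.H S (n + 1), T.IsGNSIsometry I →
        LimitOperatorWellDefined I (fun n => multiplier (F n)) ∧
        (∃ (V : HilbertLimit I ≃ₗᵢ[ℂ] L2 T.G S) (χ : ∀ n, T.Label n → Circle),
          (∀ n (x : T.Label n) (ξ : S),
            V (toHilbertLimit I n (delta x ξ)) = (χ n x : ℂ) • delta (T.label n x) ξ) ∧
          ∀ η ζ : HilbertLimit I,
            (η, ζ) ∈ (limitOperator I fun n => multiplier (F n)).graph ↔
              (V η, V ζ) ∈ (multiplier Finf).graph) ∧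
        (∃! π : T.Apro →⋆ₐ[ℂ] (HilbertLimit I →L[ℂ] HilbertLimit I), T.IsLimitRep I π) ∧
        ∀ π : T.Apro →⋆ₐ[ℂ] (HilbertLimit I →L[ℂ] HilbertLimit I), T.IsLimitRep I π →
          FiniteSpectralMultiplicity Finf → BoundedTranslationIncrements Finf →
            IsSpectralTriple (A := T.Apro) π (limitOperator I fun n => multiplier (F n)) := by
  obtain ⟨Finf, hFinf⟩ := T.exists_limit_function F hF_compat
  refine ⟨Finf, hFinf, ?_, fun I hI => ?_⟩
  · exact T.exists_isGNSIsometry.imp fun I hI => ⟨hI, fun I' hI' => hI'.eq hI⟩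
  · have hD := hI.isLabelDiagonal_limitOperator hFinf
    exact ⟨hD.1, hD.2, hI.existsUnique_isLimitRep,
      fun π hπ hF_mult hF_incr => hπ.isSpectralTriple hD.2 hF_mult hF_incr⟩

open Protorus in
theorem mainTheorem11 (T : ToricSystem)
    (S : Type) [NormedAddCommGroup S] [InnerProductSpace ℂ S] [CompleteSpace S]
    [FiniteDimensional ℂ S] [Nontrivial S]
    (F : ∀ n, T.Label n → selfAdjoint (S →L[ℂ] S))
    (hF_mult : ∀ n, FiniteSpectralMultiplicity (F n))
    (hF_incr : ∀ n, BoundedTranslationIncrements (F n))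
    (hF_compat : ∀ n (x : T.Label n), F (n + 1) ((T.M n).mulVec x) = F n x)
    (h_smooth : ∀ n (a : T.A n), a ∈ boundedCommutators (T.π S n) (multiplier (F n)) →
      T.φ n a ∈ boundedCommutators (T.π S (n + 1)) (multiplier (F (n + 1)))) :
    ∃ Finf : T.G → selfAdjoint (S →L[ℂ] S),
      (∀ n (x : T.Label n), Finf (T.label n x) = F n x) ∧
      (∃! I : ∀ n, T.H S n →ₗᵢ[ℂ] T.H S (n + 1), T.IsGNSIsometry I) ∧
      ∀ I : ∀ n, T.H S n →ₗᵢ[ℂ] T.H S (n + 1), T.IsGNSIsometry I →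
        LimitOperatorWellDefined I (fun n => multiplier (F n)) ∧
        (∃ (V : HilbertLimit I ≃ₗᵢ[ℂ] L2 T.G S) (χ : ∀ n, T.Label n → Circle),
          (∀ n (x : T.Label n) (ξ : S),
            V (toHilbertLimit I n (delta x ξ)) = (χ n x : ℂ) • delta (T.label n x) ξ) ∧
          ∀ η ζ : HilbertLimit I,
            (η, ζ) ∈ (limitOperator I fun n => multiplier (F n)).graph ↔
              (V η, V ζ) ∈ (multiplier Finf).graph) ∧
        (∃! π : T.Apro →⋆ₐ[ℂ] (HilbertLimit I →L[ℂ] HilbertLimit I), T.IsLimitRep I π) ∧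
        ∀ π : T.Apro →⋆ₐ[ℂ] (HilbertLimit I →L[ℂ] HilbertLimit I), T.IsLimitRep I π →
          FiniteSpectralMultiplicity Finf → BoundedTranslationIncrements Finf →
            IsSpectralTriple (A := T.Apro) π (limitOperator I fun n => multiplier (F n)) := by
  exact mainTheorem11_general T S F hF_compat
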